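/- Let $N\ge 2$, let $A=\{a_1,\dots,a_N\}$ be a free basis of the free group $F_N$, let $X$ be the Cayley tree of $(F_N,A)$, and let $\partial X=\partial F_N$ be its boundary. Let $\mathcal C_N$ be the space of closed subsets $S\subset\partial F_N$ with $\#S\ge 2$, with the (subspace topology of the) Vietoris topology. A subset current is an $F_N$-invariant Borel measure on $\mathcal C_N$ that is finite on compact sets. For a nontrivial finitely generated subgroup $H\le F_N$ let $\Lambda(H)\subset\partial F_N$ be its limit set, $\widehat H=\mathrm{Comm}_{F_N}(H)$ its commensurator, and $$\eta_H=[\widehat H:H]\sum_{H'\in[\widehat H]}\delta_{\Lambda(H')},$$ where $[\widehat H]$ is the conjugacy class of $\widehat H$ in $F_N$; put $\eta_{\{1\}}=0$. For subset currents $\mu,\nu$ let $\widehat I(\mu,\nu)$ be the Borel measure on $\mathcal C_N$ given by $$\widehat I(\mu,\nu)(U)=(\mu\times\nu)\bigl(\{(S_1,S_2)\in\mathcal C_N\times\mathcal C_N: S_1\cap S_2\in U\}\bigr).$$ For $S\in\mathcal C_N$ let $\mathrm{Conv}(S)$ be its convex hull in $X$. For $a\in A$ let $\mathrm{SCyl}(e_a)$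 be the set of those $S\in\mathcal C_N$ that contain both a point whose ray from $1$ passes through the edge $\{1,a\}$ and a point whose ray from $1$ does not. Let $V(\mu)=\mu(\{S: 1\in\mathrm{Conv}(S)\})$. The reduced rank functional is $$\overline{\mathrm{rk}}(\mu)=\sum_{a\in A}\mu(\mathrm{SCyl}(e_a))-V(\mu)$$ (the unique continuous $\mathbb R_{\ge0}$-linear functional with $\overline{\mathrm{rk}}(\eta_H)=\overline{\mathrm{rk}}(H):=\max\{\mathrm{rank}(H)-1,0\}$), and the intersection functional is $$\mathcal N(\mu,\nu)=\sum_{a\in A}\mu(\mathrm{SCyl}(e_a))\,\nu(\mathrm{SCyl}(e_a))-V(\mu)V(\nu)+\sum_{[T]}(\mu\times\nu)\bigl(\{(S_1,S_2):\mathrm{Conv}(S_1)\cap\mathrm{Conv}(S_2)=T\}\bigr),$$ where $[T]$ runs over the finite subtrees $T$ of $X$ containing $1$ (including $T=\{1\}$) up to translation by $F_N$ (it is the unique continuous symmetric $\mathbb R_{\ge0}$-bilinear functional with $\mathcal N(\eta_H,\eta_K)=\sum_{HgK}\overline{\mathrm{rk}}(H\cap gKg^{-1})$). **Theorem.** Let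 $H,K\le F_N$ be nontrivial finitely generated subgroups. Then $\eta_H$, $\eta_K$ and $\widehat I(\eta_H,\eta_K)$ are subset currents, and $$\widehat I(\eta_H,\eta_K)=\sum_{HgK\in H\backslash F_N/K}\eta_{H\cap gKg^{-1}},$$ for any choice of representatives $g$ of the double cosets. Hence $$\overline{\mathrm{rk}}\bigl(\widehat I(\eta_H,\eta_K)\bigr)=\mathcal N(\eta_H,\eta_K)=\sum_{HgK\in H\backslash F_N/K}\overline{\mathrm{rk}}(H\cap gKg^{-1}).$$ -/

import Mathlib

open MeasureTheory TopologicalSpace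
open scoped Pointwise

noncomputable section

namespace SubsetCurrent

/-! ### The boundary of the free group

The free group `F_N` is `FreeGroup (Fin N)`.  A letter `(a, true)` stands for the basis element `a`
and `(a, false)` for its inverse.  The Cayley graph `X` of `F_N` with respect to the basis is a
tree; its boundary is the set of geodesic rays from the identity, i.e. of infinite reduced words. -/

/-- The inverse letter. -/
def invLetter {N : ℕ} (x : Fin N × Bool) : Fin N × Bool := (x.1, !x.2)

theorem invLetter_invLetter {N : ℕ} (x : Fin N × Bool) : invLetter (invLetter x) = x := by
  simp [invLetter]

/-- The boundary `∂F_N = ∂X`: infinite reduced words in the letters. It carries the subspace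
topology of the product topology, of which the cylinders are a basis. -/
def Boundary (N : ℕ) : Type :=
  {ξ : ℕ → Fin N × Bool // ∀ n, ξ (n + 1) ≠ invLetter (ξ n)}

instance (N : ℕ) : TopologicalSpace (Boundary N) :=
  inferInstanceAs (TopologicalSpace {ξ : ℕ → Fin N × Bool // ∀ n, ξ (n + 1) ≠ invLetter (ξ n)})

instance (N : ℕ) : T2Space (Boundary N) :=
  inferInstanceAs (T2Space {ξ : ℕ → Fin N × Bool // ∀ n, ξ (n + 1) ≠ invLetter (ξ n)})

instance (N : ℕ) : CompactSpace (Boundary N) := by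
  have h : IsClosed {ξ : ℕ → Fin N × Bool | ∀ n, ξ (n + 1) ≠ invLetter (ξ n)} := by
    have e : {ξ : ℕ → Fin N × Bool | ∀ n, ξ (n + 1) ≠ invLetter (ξ n)} =
        ⋂ n, (fun ξ : ℕ → Fin N × Bool => (ξ (n + 1), ξ n)) ⁻¹'
          {p | p.1 ≠ invLetter p.2} := by
      ext ξ; simp
    rw [e]
    exact isClosed_iInter fun n => (isClosed_discrete _).preimage (by fun_prop)
  exact isCompact_iff_compactSpace.mp h.isCompact

/-- Left multiplication of an infinite reduced word by a letter, with cancellation. -/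
def letterMul {N : ℕ} (x : Fin N × Bool) (ξ : Boundary N) : Boundary N :=
  ⟨fun n => if ξ.1 0 = invLetter x then ξ.1 (n + 1) else if n = 0 then x else ξ.1 (n - 1), by
    intro n
    by_cases h : ξ.1 0 = invLetter x
    · simp [h, ξ.2 (n + 1)]
    · rcases n with _ | n
      · simp [h]
      · simpa [h] using ξ.2 n⟩

theorem letterMul_invLetter {N : ℕ} (x : Fin N × Bool) (ξ : Boundary N) :
    letterMul (invLetter x) (letterMul x ξ) = ξ := by
  apply Subtype.ext
  funext n
  by_cases h : ξ.1 0 = invLetter x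
  · have h1 : ξ.1 1 ≠ x := by
      have := ξ.2 0
      rw [h, invLetter_invLetter] at this
      simpa using this
    rcases n with _ | n
    · simp [letterMul, h, invLetter_invLetter, h1]
    · simp [letterMul, h, invLetter_invLetter, h1]
  · simp [letterMul, h, invLetter_invLetter]

theorem continuous_letterMul {N : ℕ} (x : Fin N × Bool) :
    Continuous (letterMul x : Boundary N → Boundary N) := by
  refine Continuous.subtype_mk (continuous_pi fun n => ?_) _
  have hc : ∀ k, Continuous fun ξ : Boundary N => ξ.1 k := fun k =>
    (continuous_apply k).comp continuous_subtype_val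
  exact (continuous_of_discreteTopology
    (f := fun p : (Fin N × Bool) × (Fin N × Bool) × (Fin N × Bool) =>
      if p.1 = invLetter x then p.2.1 else if n = 0 then x else p.2.2)).comp
    ((hc 0).prodMk ((hc (n + 1)).prodMk (hc (n - 1))))

/-- The homeomorphism of the boundary given by left multiplication by a basis element. -/
def letterHomeo {N : ℕ} (a : Fin N) : Boundary N ≃ₜ Boundary N where
  toFun := letterMul (a, true)
  invFun := letterMul (a, false)
  left_inv ξ := letterMul_invLetter (a, true) ξ
  right_inv ξ := letterMul_invLetter (a, false) ξ
  continuous_toFun := continuous_letterMul _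
  continuous_invFun := continuous_letterMul _

/-- The left action of `F_N` on its boundary by homeomorphisms. -/
def boundaryAction (N : ℕ) : FreeGroup (Fin N) →* (Boundary N ≃ₜ Boundary N) :=
  FreeGroup.lift letterHomeo

/-! ### The space `C_N` and subset currents -/

/-- The hyperspace of all closed subsets of `∂F_N`.  As `∂F_N` is compact Hausdorff, closed means
compact, and the topology of `Compacts` is the Vietoris topology. -/
abbrev Hyperspace (N : ℕ) : Type := Compacts (Boundary N)

instance (N : ℕ) : MeasurableSpace (Hyperspace N) := borel _

instance (N : ℕ) : BorelSpace (Hyperspace N) := ⟨rfl⟩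

/-- The space `C_N` of closed subsets of `∂F_N` with at least two points. -/
abbrev CSpace (N : ℕ) : Type := {S : Hyperspace N // (S : Set (Boundary N)).Nontrivial}

/-- The left action of `F_N` on `C_N`. -/
def translate {N : ℕ} (g : FreeGroup (Fin N)) (S : CSpace N) : CSpace N :=
  ⟨S.1.map (boundaryAction N g) (boundaryAction N g).continuous,
    by
      rw [Compacts.coe_map]
      exact S.2.image (boundaryAction N g).injective⟩

/-- A Borel measure on `C_N` is a subset current if it is `F_N`-invariant and locally finite,
i.e. finite on compact subsets. -/
def IsSubsetCurrent {N : ℕ} (μ : Measure (CSpace N)) : Prop :=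
  (∀ g : FreeGroup (Fin N), μ.map (translate g) = μ) ∧
    ∀ C : Set (CSpace N), IsCompact C → μ C < ⊤

/-! ### Counting subset currents -/

/-- The limit set of a subgroup: all `ξ` for which some sequence `h n` in `H` converges to `ξ` in
`X ∪ ∂X`, i.e. every finite prefix of `ξ` is eventually a prefix of the reduced word of `h n`. -/
def limitSet {N : ℕ} (H : Subgroup (FreeGroup (Fin N))) : Set (Boundary N) :=
  {ξ | ∃ h : ℕ → FreeGroup (Fin N), (∀ n, h n ∈ H) ∧
    ∀ k : ℕ, ∀ᶠ n in Filter.atTop, List.ofFn (fun i : Fin k => ξ.1 i) <+: (h n).toWord}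

open Classical in
/-- The Dirac measure on `C_N` at a set `S`: `U ↦ 1` if `S ∈ U` and `U ↦ 0` otherwise
(so it is zero if `S` is not a point of `C_N`). -/
def diracAt {N : ℕ} (S : Set (Boundary N)) : Measure (CSpace N) :=
  if h : IsClosed S ∧ S.Nontrivial then Measure.dirac ⟨⟨S, h.1.isCompact⟩, h.2⟩ else 0

/-- The conjugate `g H g⁻¹`. -/
def conjSubgroup {G : Type*} [Group G] (g : G) (H : Subgroup G) : Subgroup G :=
  H.map (MulAut.conj g).toMonoidHom

open Classical in
/-- The counting subset current `η_H = [Ĥ : H] ∑_{H' ∈ [Ĥ]} δ_{Λ(H')}`, where `Ĥ` is the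
commensurator of `H` in `F_N` and `[Ĥ]` its conjugacy class; `η_H = 0` for trivial `H`. -/
def counting {N : ℕ} (H : Subgroup (FreeGroup (Fin N))) : Measure (CSpace N) :=
  if H = ⊥ then 0
  else
    H.relIndex (Subgroup.Commensurable.commensurator H) •
      Measure.sum fun H' : Set.range fun g : FreeGroup (Fin N) =>
          conjSubgroup g (Subgroup.Commensurable.commensurator H) =>
        diracAt (limitSet H'.1)

/-! ### The intersection map -/

/-- The intersection map `I : C_N × C_N → {closed subsets of ∂F_N}`. -/
def interMap {N : ℕ} (p : CSpace N × CSpace N) : Hyperspace N := p.1.1 ⊓ p.2.1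

/-- The measure `Î(μ, ν)` on `C_N`: `Î(μ, ν)(U) = (μ × ν)(I⁻¹(U))` for Borel `U ⊆ C_N`. It is the
restriction to `C_N`, an open subspace of the hyperspace, of the push-forward of `μ × ν` by `I`. -/
def interCurrent {N : ℕ} (μ ν : Measure (CSpace N)) : Measure (CSpace N) :=
  ((μ.prod ν).map interMap).comap Subtype.val

/-! ### The reduced rank functional -/

/-- The vertices of the convex hull of `S ⊆ ∂X` in the tree `X`, i.e. of the union of the
bi-infinite geodesics between points of `S`. A vertex `v` lies on the geodesic between `ξ` and `ζ`
if and only if the rays from `v` to `ξ` and `ζ` start with different edges. -/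
def conv {N : ℕ} (S : Set (Boundary N)) : Set (FreeGroup (Fin N)) :=
  {v | ∃ ξ ∈ S, ∃ ζ ∈ S, (boundaryAction N v⁻¹ ξ).1 0 ≠ (boundaryAction N v⁻¹ ζ).1 0}

/-- The subset cylinder of the edge from `1` to the basis element `a`: all `S` which meet the
cylinders of both orientations of this edge, i.e. which contain a ray from `1` through this edge
and a ray from `1` not through this edge. -/
def edgeSCyl {N : ℕ} (a : Fin N) : Set (CSpace N) :=
  {S | (∃ ξ ∈ S.1, ξ.1 0 = (a, true)) ∧ ∃ ζ ∈ S.1, ζ.1 0 ≠ (a, true)}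

/-- The functional `E(μ) = ∑_a μ(SCyl(e_a))`. -/
def edgeFunctional {N : ℕ} (μ : Measure (CSpace N)) : ℝ := ∑ a, μ.real (edgeSCyl a)

/-- The functional `V(μ) = μ {S | 1 ∈ Conv S}`; the set is the disjoint union of the subset
cylinders of the round graphs of grade one around `1`. -/
def vertexFunctional {N : ℕ} (μ : Measure (CSpace N)) : ℝ :=
  μ.real {S | (1 : FreeGroup (Fin N)) ∈ conv (S.1 : Set (Boundary N))}

/-- The reduced rank functional `E - V`. -/
def rankFunctional {N : ℕ} (μ : Measure (CSpace N)) : ℝ := edgeFunctional μ - vertexFunctional μ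

/-- The reduced rank `max (rank H - 1) 0` of a finitely generated subgroup of a free group, where
the rank is the cardinality of a free basis (such a subgroup is free). -/
def reducedRank {N : ℕ} (H : Subgroup (FreeGroup (Fin N))) : ℕ :=
  Nat.card (IsFreeGroup.Generators H) - 1

/-! ### The intersection functional -/

/-- The Cayley tree `X` of `F_N`. -/
def cayley (N : ℕ) : SimpleGraph (FreeGroup (Fin N)) :=
  SimpleGraph.fromRel fun g h => ∃ a, h = g * FreeGroup.of a

/-- Finite subtrees of `X` (given by their vertex sets) which contain the vertex `1`; the tree with
one vertex is allowed. -/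
def BasedSubtree (N : ℕ) : Type :=
  {T : Set (FreeGroup (Fin N)) // T.Finite ∧ 1 ∈ T ∧ ((cayley N).induce T).Connected}

/-- Two based subtrees are equivalent if they are translates of each other. -/
instance subtreeSetoid (N : ℕ) : Setoid (BasedSubtree N) where
  r T T' := ∃ g : FreeGroup (Fin N), g • T.1 = T'.1
  iseqv :=
    { refl := fun _ => ⟨1, one_smul _ _⟩
      symm := fun ⟨g, h⟩ => ⟨g⁻¹, by rw [← h, inv_smul_smul]⟩
      trans := fun ⟨g, h⟩ ⟨g', h'⟩ => ⟨g' * g, by rw [mul_smul, h, h']⟩ }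

/-- The set `R(T)` of all pairs `(S₁, S₂)` with `Conv S₁ ∩ Conv S₂ = T`. -/
def pairsOver {N : ℕ} (T : Set (FreeGroup (Fin N))) : Set (CSpace N × CSpace N) :=
  {p | conv (p.1.1 : Set (Boundary N)) ∩ conv (p.2.1 : Set (Boundary N)) = T}

/-- The functional `ĉ(μ, ν) = ∑_{[T]} (μ × ν)(R(T))`, the sum being over the classes of based
subtrees up to translation. -/
def contractibleFunctional {N : ℕ} (μ ν : Measure (CSpace N)) : ℝ :=
  (∑' q : Quotient (subtreeSetoid N), (μ.prod ν) (pairsOver q.out.1)).toReal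

/-- The intersection functional
`𝒩(μ, ν) = ∑_a μ(SCyl(e_a)) ν(SCyl(e_a)) - V(μ) V(ν) + ĉ(μ, ν)`. -/
def intersectionFunctional {N : ℕ} (μ ν : Measure (CSpace N)) : ℝ :=
  (∑ a, μ.real (edgeSCyl a) * ν.real (edgeSCyl a)) - vertexFunctional μ * vertexFunctional ν +
    contractibleFunctional μ ν

end SubsetCurrent

end

noncomputable section

namespace SubsetCurrent

variable {N : ℕ}

/-! ### Letters and reduced words -/

/-! The current `counting H` is the sum of Dirac masses at `gΛ(H)` over the cosets `gH`
(`counting_eq_sumDirac`): the commensurator is the stabilizer of `Λ(H)`, and each of its cosets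
splits into `[Ĥ : H]` cosets of `H`. Hence the intersection current is a sum over pairs of cosets
`(aH, bK)` of masses at `aΛ(H) ∩ bΛ(K)`. The orbits of `F_N` on such pairs are the double cosets,
with stabilizers `L = H ∩ gKg⁻¹` (`sigmaEquivProd`), and `Λ(H) ∩ gΛ(K) = Λ(L)` (`limitSet_inf`).
Regrouping by orbits gives the formula for the currents.

Finite generation enters only through cocompactness: `H` acts with finitely many vertex orbits on
the hull of `Λ(H)`, and this property passes to intersections (`IsCocompact.inter`).

Both functionals count sets or pairs at the vertex `1`. For one double coset these counts are
numbers of `L`-orbits of vertices and edges of an `L`-invariant convex set `T`. By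
`sum_card_edgeCosets_add_one`, edge orbits minus vertex orbits equal `rank L - 1` for every nonempty
cocompact `T`, whichever it is. For the rank functional `T` is the hull of `Λ(L)`. For the
intersection functional `T` is the intersection of the hulls of `Λ(H)` and `gΛ(K)`, which may be
nonempty although `L` is trivial. Then `T` is a finite tree, the difference is `-1`, and the sum
over based subtrees contributes the missing `1`; for nontrivial `L` the set `T` is infinite and that
sum contributes nothing. -/

/-- The element of the free group given by a letter. -/
def letter (x : Fin N × Bool) : FreeGroup (Fin N) := FreeGroup.mk [x]

theorem letter_invLetter (x : Fin N × Bool) : letter (invLetter x) = (letter x)⁻¹ := by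
  simp [letter, invLetter, FreeGroup.inv_mk, FreeGroup.invRev]

theorem toWord_letter (x : Fin N × Bool) : (letter x).toWord = [x] := by
  simp [letter, FreeGroup.toWord_mk]

theorem toWord_letter_mul (x : Fin N × Bool) (g : FreeGroup (Fin N)) :
    (letter x * g).toWord =
      if g.toWord.head? = some (invLetter x) then g.toWord.tail else x :: g.toWord := by
  rw [FreeGroup.toWord_mul, toWord_letter, List.singleton_append, FreeGroup.reduce.cons,
    FreeGroup.reduce_toWord]
  rcases g.toWord with _ | ⟨y, t⟩
  · simp
  · rcases x with ⟨a, b⟩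
    rcases y with ⟨a', b'⟩
    cases b <;> cases b' <;> by_cases h : a = a' <;> simp [invLetter, h, eq_comm]

/-- After a cancellation the new first letter cannot be `x`: it would have stood next to the
cancelled `x⁻¹` in a reduced word. -/
theorem head_letter_mul (x : Fin N × Bool) (g : FreeGroup (Fin N)) :
    (letter x * g).toWord.head? = some x ↔ g.toWord.head? ≠ some (invLetter x) := by
  rw [toWord_letter_mul]
  split_ifs with h
  · simp only [h, ne_eq, not_true_eq_false, iff_false]
    intro h'
    have hr : FreeGroup.IsReduced g.toWord := FreeGroup.isReduced_toWord
    rcases hg : g.toWord with _ | ⟨y, _ | ⟨z, t⟩⟩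
    · simp [hg] at h
    · simp [hg] at h'
    · rw [hg] at h h' hr
      simp only [List.head?_cons, Option.some.injEq, List.tail_cons] at h h'
      subst h h'
      have := (List.isChain_cons_cons.mp hr).1
      simp [invLetter] at this
  · simpa using h

theorem exists_of_toWord_eq_cons {g : FreeGroup (Fin N)} {x : Fin N × Bool}
    {L : List (Fin N × Bool)} (h : g.toWord = x :: L) :
    ∃ g', g = letter x * g' ∧ g'.toWord = L ∧ L.head? ≠ some (invLetter x) := by
  refine ⟨(letter x)⁻¹ * g, by simp, ?_⟩
  have h1 : ((letter x)⁻¹ * g).toWord = L := by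
    rw [← letter_invLetter, toWord_letter_mul, if_pos (by simp [h, invLetter_invLetter]), h,
      List.tail_cons]
  refine ⟨h1, ?_⟩
  rw [← h1, ← head_letter_mul, mul_inv_cancel_left, h, List.head?_cons]

theorem letter_induction {P : FreeGroup (Fin N) → Prop} (g : FreeGroup (Fin N)) (h1 : P 1)
    (hm : ∀ x g, P g → P (letter x * g)) : P g := by
  obtain ⟨L, hL⟩ : ∃ L, g.toWord = L := ⟨_, rfl⟩
  induction L generalizing g with
  | nil => rw [FreeGroup.toWord_eq_nil_iff] at hL; rwa [hL]
  | cons x L ih =>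
    obtain ⟨g', rfl, h', -⟩ := exists_of_toWord_eq_cons hL
    exact hm _ _ (ih g' h')

/-! ### Directions -/

/-- The letter of the first edge of the geodesic from the vertex `v` to the vertex `p`. -/
def dir (v p : FreeGroup (Fin N)) : Option (Fin N × Bool) := (v⁻¹ * p).toWord.head?

theorem dir_mul (g v p : FreeGroup (Fin N)) : dir (g * v) (g * p) = dir v p := by
  simp [dir, mul_assoc]

theorem dir_mul_left (g v p : FreeGroup (Fin N)) : dir v (g * p) = dir (g⁻¹ * v) p := by
  simp [dir, mul_assoc]

theorem dir_eq_none {v p : FreeGroup (Fin N)} : dir v p = none ↔ v = p := by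
  rw [dir, List.head?_eq_none_iff, FreeGroup.toWord_eq_nil_iff, inv_mul_eq_one]

instance : MulAction (FreeGroup (Fin N)) (Boundary N) where
  smul g ξ := boundaryAction N g ξ
  one_smul ξ := by
    change boundaryAction N 1 ξ = ξ
    rw [map_one]; rfl
  mul_smul g h ξ := by
    change boundaryAction N (g * h) ξ = boundaryAction N g (boundaryAction N h ξ)
    rw [map_mul]; rfl

theorem smul_eq_boundaryAction (g : FreeGroup (Fin N)) (ξ : Boundary N) :
    g • ξ = boundaryAction N g ξ := rfl

theorem letter_smul (x : Fin N × Bool) (ξ : Boundary N) : letter x • ξ = letterMul x ξ := by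
  rw [smul_eq_boundaryAction]
  rcases x with ⟨a, _ | _⟩
  · have h : letter (a, false) = (FreeGroup.of a)⁻¹ := rfl
    rw [h, map_inv, boundaryAction, FreeGroup.lift_apply_of]; rfl
  · have h : letter (a, true) = FreeGroup.of a := rfl
    rw [h, boundaryAction, FreeGroup.lift_apply_of]; rfl

/-- The letter of the first edge of the geodesic from the vertex `v` to the boundary point `ξ`. -/
def bdir (v : FreeGroup (Fin N)) (ξ : Boundary N) : Fin N × Bool := (v⁻¹ • ξ).1 0

theorem bdir_smul (g v : FreeGroup (Fin N)) (ξ : Boundary N) :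
    bdir v (g • ξ) = bdir (g⁻¹ * v) ξ := by
  simp [bdir, mul_smul]

theorem letterMul_zero_iff (x : Fin N × Bool) (ξ : Boundary N) :
    (letterMul x ξ).1 0 = x ↔ ξ.1 0 ≠ invLetter x := by
  by_cases h : ξ.1 0 = invLetter x
  · have := ξ.2 0
    rw [h, invLetter_invLetter] at this
    simpa [letterMul, h] using this
  · simp [letterMul, h]

/-- The property of the functions that assign to every vertex the first edge of the geodesic to a
fixed vertex or boundary point. -/
def IsFlow (d : FreeGroup (Fin N) → Option (Fin N × Bool)) : Prop :=
  ∀ v x, d v = some x ↔ d (v * letter x) ≠ some (invLetter x)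

/-- In a tree, exactly one end of an edge looks across that edge towards `p`. -/
theorem isFlow_dir (p : FreeGroup (Fin N)) : IsFlow fun v => dir v p := by
  intro v x
  have := head_letter_mul (invLetter x) (v⁻¹ * p)
  rw [invLetter_invLetter] at this
  simp only [dir, mul_inv_rev, mul_assoc, ← letter_invLetter]
  rw [ne_eq, this, not_not]

theorem isFlow_bdir (ξ : Boundary N) : IsFlow fun v => some (bdir v ξ) := by
  intro v x
  have := letterMul_zero_iff (invLetter x) (v⁻¹ • ξ)
  rw [invLetter_invLetter] at this
  simp only [bdir, mul_inv_rev, mul_smul, ← letter_invLetter, letter_smul, ne_eq,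
    Option.some.injEq]
  rw [this, not_not]

/-- A flow that does not step back along the last edge of the geodesic from `v` to `u` must cross
this edge forwards, hence does not step back along the edge before it, and so on down to `v`. The
convexity arguments rest on this. -/
theorem IsFlow.eq_dir {d : FreeGroup (Fin N) → Option (Fin N × Bool)} (hd : IsFlow d)
    {u v : FreeGroup (Fin N)} (huv : u ≠ v) (h : d u ≠ dir u v) : d v = dir v u := by
  obtain ⟨w, rfl⟩ : ∃ w, u = v * w := ⟨v⁻¹ * u, by simp⟩
  have hw : w ≠ 1 := by simpa using huv
  have e1 : dir (v * w) v = w⁻¹.toWord.head? := by simp [dir]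
  have e2 : dir v (v * w) = w.toWord.head? := by simp [dir]
  rw [e1] at h
  rw [e2]
  clear e1 e2 huv
  obtain ⟨L, hL⟩ : ∃ L, w.toWord = L := ⟨_, rfl⟩
  induction L generalizing w v with
  | nil => rw [FreeGroup.toWord_eq_nil_iff] at hL; exact absurd hL hw
  | cons x L ih =>
    obtain ⟨w', rfl, h', hx⟩ := exists_of_toWord_eq_cons hL
    rw [hL, List.head?_cons, hd]
    by_cases hw' : w' = 1
    · subst hw'
      rwa [mul_one, ← letter_invLetter, toWord_letter, List.head?_cons] at h
    · have hl : L ≠ [] := by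
        rw [← h', ne_eq, FreeGroup.toWord_eq_nil_iff]; exact hw'
      rw [ih (v := v * letter x) w' (hw := hw') (h := ?_) (hL := h'), h']
      · exact hx
      -- Both heads come from the last letter of the word, which prepending `x` to a nonempty word
      -- does not change.
      · have e : w'⁻¹.toWord.head? = (letter x * w')⁻¹.toWord.head? := by
          rw [FreeGroup.toWord_inv, FreeGroup.toWord_inv, hL, h', FreeGroup.invRev,
            FreeGroup.invRev, List.head?_reverse, List.head?_reverse]
          rcases L with _ | ⟨y, L⟩
          · exact absurd rfl hl
          · simp [List.getLast?_cons]
        rwa [e, mul_assoc]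

/-- These are the vertices of the geodesic from `1` to `c`. The geodesic to `xg` is covered by the
edge from `1` to `x` and the translate by `x` of the geodesic to `g`. -/
theorem finite_dir_ne (c : FreeGroup (Fin N)) : {w | dir w 1 ≠ dir w c}.Finite := by
  induction c using letter_induction with
  | h1 => simp
  | hm x g ih =>
    refine (((Set.finite_singleton (letter x)).insert 1).union
      (ih.image (letter x * ·))).subset ?_
    intro w hw
    by_cases h : dir w 1 = dir w (letter x)
    · right
      refine ⟨(letter x)⁻¹ * w, ?_, by simp⟩
      have h2 : dir w (letter x) = dir ((letter x)⁻¹ * w) 1 := by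
        rw [← dir_mul_left, mul_one]
      rw [Set.mem_ofPred_eq, ← h2, ← dir_mul_left, ← h]
      exact hw
    · left
      by_contra hc
      simp only [Set.mem_insert_iff, Set.mem_singleton_iff, not_or] at hc
      apply h
      by_contra h3
      -- If `w` saw the two ends of this edge in different directions, each end would see `w` across
      -- the edge, which no flow allows.
      have h4 := (isFlow_dir (letter x)).eq_dir (u := w) (v := 1) hc.1 (fun e => h3 e.symm)
      have h5 : dir 1 (letter x) = some x := by simp [dir, toWord_letter]
      simp only [h5] at h4
      have h6 := (isFlow_dir (1 : FreeGroup (Fin N))).eq_dir (u := w) (v := letter x) hc.2 h3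
      have h7 : dir (letter x) 1 = some (invLetter x) := by
        simp [dir, ← letter_invLetter, toWord_letter]
      simp only [h7] at h6
      have h8 := (isFlow_dir w) 1 x
      simp only [one_mul] at h8
      exact h8.1 h4.symm h6.symm

/-! ### Convergence to boundary points -/

/-- The vertices on the ray from `1` to `ξ`. -/
def ray (ξ : Boundary N) : ℕ → FreeGroup (Fin N)
  | 0 => 1
  | n + 1 => ray ξ n * letter (ξ.1 n)

theorem ray_inv_smul (ξ : Boundary N) (n i : ℕ) : ((ray ξ n)⁻¹ • ξ).1 i = ξ.1 (n + i) := by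
  induction n generalizing i with
  | zero => simp [ray]
  | succ n ih =>
    rw [ray, mul_inv_rev, mul_smul, ← letter_invLetter, letter_smul]
    have h0 := ih 0
    simp only [letterMul, h0, invLetter_invLetter, add_zero, if_true, ih]
    rw [show n + 1 + i = n + (i + 1) by ring]

theorem bdir_ray (ξ : Boundary N) (n : ℕ) : bdir (ray ξ n) ξ = ξ.1 n := ray_inv_smul ξ n 0

theorem ofFn_prefix_iff {α : Type*} {f : ℕ → α} {k : ℕ} {l : List α} :
    List.ofFn (fun i : Fin k => f i) <+: l ↔ ∀ i < k, l[i]? = some (f i) := by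
  constructor
  · rintro ⟨t, rfl⟩ i hi
    rw [List.getElem?_append_left (by simpa using hi)]
    simp [hi]
  · intro h
    have hk : k ≤ l.length := by
      rcases k with _ | k
      · simp
      · have := h k (by simp)
        rw [List.getElem?_eq_some_iff] at this
        exact this.1
    rw [List.prefix_iff_eq_take]
    refine List.ext_getElem? fun i => ?_
    by_cases hi : i < k
    · simp [hi, h i hi]
    · simp [hi]

theorem mem_limitSet {H : Subgroup (FreeGroup (Fin N))} {ξ : Boundary N} :
    ξ ∈ limitSet H ↔ ∀ k, ∃ h ∈ H, ∀ i < k, h.toWord[i]? = some (ξ.1 i) := by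
  constructor
  · rintro ⟨h, hH, ht⟩ k
    obtain ⟨n, hn⟩ := (ht k).exists
    exact ⟨h n, hH n, ofFn_prefix_iff.1 hn⟩
  · intro h
    choose g hg hg' using h
    refine ⟨g, hg, fun k => ?_⟩
    filter_upwards [Filter.eventually_ge_atTop k] with n hn
    exact ofFn_prefix_iff.2 fun i hi => hg' n i (hi.trans_le hn)

/-- Convergence of a sequence of vertices to a boundary point. -/
def ConvergesTo (h : ℕ → FreeGroup (Fin N)) (ξ : Boundary N) : Prop :=
  ∀ v, ∀ᶠ n in Filter.atTop, dir v (h n) = some (bdir v ξ)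

/-- Cancellation consumes at most one letter, so agreement on `k + 1` letters leaves agreement on
`k`. -/
theorem getElem?_letter_mul {x : Fin N × Bool} {g : FreeGroup (Fin N)} {ξ : Boundary N} {k : ℕ}
    (h : ∀ i < k + 1, g.toWord[i]? = some (ξ.1 i)) :
    ∀ i < k, (letter x * g).toWord[i]? = some ((letter x • ξ).1 i) := by
  intro i hi
  have h0 : g.toWord.head? = some (ξ.1 0) := by
    rw [List.head?_eq_getElem?]; exact h 0 (by omega)
  rw [letter_smul, toWord_letter_mul, h0]
  by_cases hx : ξ.1 0 = invLetter x
  · simp [hx, letterMul, h (i + 1) (by omega)]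
  · rcases i with _ | i
    · simp [hx, letterMul]
    · simp [hx, letterMul, h i (by omega)]

theorem toWord_eventually_smul {h : ℕ → FreeGroup (Fin N)} {ξ : Boundary N}
    (hh : ∀ k, ∀ᶠ n in Filter.atTop, ∀ i < k, (h n).toWord[i]? = some (ξ.1 i))
    (g : FreeGroup (Fin N)) (k : ℕ) :
    ∀ᶠ n in Filter.atTop, ∀ i < k, (g * h n).toWord[i]? = some ((g • ξ).1 i) := by
  induction g using letter_induction generalizing k with
  | h1 => simpa using hh k
  | hm x g ih =>
    filter_upwards [ih (k + 1)] with n hn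
    simpa only [mul_assoc, mul_smul] using getElem?_letter_mul hn

theorem toWord_of_dir {g : FreeGroup (Fin N)} {ξ : Boundary N} {k : ℕ}
    (h : ∀ i < k, dir (ray ξ i) g = some (ξ.1 i)) : ∀ i < k, g.toWord[i]? = some (ξ.1 i) := by
  have key : ∀ j ≤ k, ((ray ξ j)⁻¹ * g).toWord = g.toWord.drop j := by
    intro j hj
    induction j with
    | zero => simp [ray]
    | succ j ih =>
      have hd := h j (by omega)
      rw [dir] at hd
      rw [ray, mul_inv_rev, mul_assoc, ← letter_invLetter, toWord_letter_mul,
        if_pos (by rw [hd, invLetter_invLetter]), ih (by omega), List.tail_drop]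
  intro i hi
  have := h i hi
  rw [dir, key i hi.le, List.head?_drop] at this
  exact this

/-- Prefixes only record directions seen from the vertices of one ray. The version with directions
from all vertices is visibly compatible with translation. -/
theorem convergesTo_iff {h : ℕ → FreeGroup (Fin N)} {ξ : Boundary N} :
    ConvergesTo h ξ ↔
      ∀ k : ℕ, ∀ᶠ n in Filter.atTop, List.ofFn (fun i : Fin k => ξ.1 i) <+: (h n).toWord := by
  simp only [ofFn_prefix_iff]
  constructor
  · intro hc k
    have : ∀ᶠ n in Filter.atTop, ∀ i ∈ Finset.range k, dir (ray ξ i) (h n) = some (ξ.1 i) := by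
      rw [Filter.eventually_all_finset]
      intro i _
      simpa only [bdir_ray] using hc (ray ξ i)
    filter_upwards [this] with n hn
    exact toWord_of_dir fun i hi => hn i (by simpa using hi)
  · intro hc v
    filter_upwards [toWord_eventually_smul hc v⁻¹ 1] with n hn
    rw [dir, List.head?_eq_getElem?, hn 0 (by omega), bdir]

theorem mem_limitSet_iff_convergesTo {H : Subgroup (FreeGroup (Fin N))} {ξ : Boundary N} :
    ξ ∈ limitSet H ↔ ∃ h : ℕ → FreeGroup (Fin N), (∀ n, h n ∈ H) ∧ ConvergesTo h ξ := by
  simp only [convergesTo_iff]; rfl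

theorem ConvergesTo.mul_left {h : ℕ → FreeGroup (Fin N)} {ξ : Boundary N}
    (hc : ConvergesTo h ξ) (g : FreeGroup (Fin N)) :
    ConvergesTo (fun n => g * h n) (g • ξ) := by
  intro v
  filter_upwards [hc (g⁻¹ * v)] with n hn
  rw [dir_mul_left, bdir_smul, hn]

theorem ConvergesTo.eventually_ne {h : ℕ → FreeGroup (Fin N)} {ξ : Boundary N}
    (hc : ConvergesTo h ξ) (p : FreeGroup (Fin N)) : ∀ᶠ n in Filter.atTop, h n ≠ p := by
  filter_upwards [hc p] with n hn
  rintro rfl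
  rw [dir_eq_none.2 rfl] at hn
  simp at hn

/-- Bounded perturbations do not change the limit: `v` sees `h n` and `h n * d` differently only if
it lies on the translate by `h n` of the geodesic from `1` to `d`. That leaves finitely many values
of `h n`, and a convergent sequence leaves each of them. -/
theorem ConvergesTo.mul_right {h : ℕ → FreeGroup (Fin N)} {ξ : Boundary N}
    (hc : ConvergesTo h ξ) {C : Set (FreeGroup (Fin N))} (hC : C.Finite)
    {c : ℕ → FreeGroup (Fin N)} (hcC : ∀ n, c n ∈ C) : ConvergesTo (fun n => h n * c n) ξ := by
  intro v
  have h1 : ∀ᶠ n in Filter.atTop, ∀ d ∈ C, dir v (h n) = dir v (h n * d) := by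
    rw [Filter.eventually_all_finite hC]
    intro d _
    have hfin := ((finite_dir_ne d).image (fun w => v * w⁻¹))
    have : ∀ᶠ n in Filter.atTop, ∀ p ∈ (fun w => v * w⁻¹) '' {w | dir w 1 ≠ dir w d}, h n ≠ p := by
      rw [Filter.eventually_all_finite hfin]
      exact fun p _ => hc.eventually_ne p
    filter_upwards [this] with n hn
    by_contra hne
    refine hn (h n) ⟨(h n)⁻¹ * v, ?_, by group⟩ rfl
    rw [Set.mem_ofPred_eq, ← dir_mul_left, ← dir_mul_left, mul_one]
    exact hne
  filter_upwards [h1, hc v] with n hn hn'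
  rw [← hn _ (hcC n), hn']

/-! ### Convex hulls -/

theorem mem_conv {S : Set (Boundary N)} {v : FreeGroup (Fin N)} :
    v ∈ conv S ↔ ∃ ξ ∈ S, ∃ ζ ∈ S, bdir v ξ ≠ bdir v ζ := Iff.rfl

theorem mem_conv_smul {S : Set (Boundary N)} {g v : FreeGroup (Fin N)} :
    v ∈ conv (g • S) ↔ g⁻¹ * v ∈ conv S := by
  simp only [mem_conv, Set.mem_smul_set, exists_exists_and_eq_and, bdir_smul]

theorem conv_smul (g : FreeGroup (Fin N)) (S : Set (Boundary N)) :
    conv (g • S) = g • conv S := by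
  ext v
  rw [mem_conv_smul, Set.mem_smul_set_iff_inv_smul_mem, smul_eq_mul]

theorem conv_mono {S S' : Set (Boundary N)} (h : S ⊆ S') : conv S ⊆ conv S' := by
  rintro v ⟨ξ, hξ, ζ, hζ, hne⟩
  exact ⟨ξ, h hξ, ζ, h hζ, hne⟩

/-- A set of vertices which contains the geodesics between its points. -/
def IsConvex (T : Set (FreeGroup (Fin N))) : Prop :=
  ∀ u ∈ T, ∀ w ∈ T, ∀ v, dir v u ≠ dir v w → v ∈ T

theorem IsConvex.inter {T T' : Set (FreeGroup (Fin N))} (h : IsConvex T) (h' : IsConvex T') :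
    IsConvex (T ∩ T') :=
  fun u hu w hw v hv => ⟨h u hu.1 w hw.1 v hv, h' u hu.2 w hw.2 v hv⟩

theorem IsConvex.smul {T : Set (FreeGroup (Fin N))} (h : IsConvex T) (g : FreeGroup (Fin N)) :
    IsConvex (g • T) := by
  intro u hu w hw v hv
  rw [Set.mem_smul_set_iff_inv_smul_mem] at *
  refine h _ hu _ hw _ ?_
  simpa only [smul_eq_mul, dir_mul] using hv

/-- Of two points of `S` that `p` sees in different directions, at least one is not on the side of
`v`; from `v` that point is seen through `p`. -/
theorem exists_bdir_eq_dir {S : Set (Boundary N)} {p v : FreeGroup (Fin N)} (hp : p ∈ conv S)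
    (hv : p ≠ v) : ∃ ξ ∈ S, some (bdir v ξ) = dir v p := by
  obtain ⟨ξ, hξ, ζ, hζ, hne⟩ := hp
  by_cases h : some (bdir p ξ) = dir p v
  · refine ⟨ζ, hζ, (isFlow_bdir ζ).eq_dir hv fun h' => hne ?_⟩
    exact Option.some_injective _ (h.trans h'.symm)
  · exact ⟨ξ, hξ, (isFlow_bdir ξ).eq_dir hv h⟩

theorem isConvex_conv (S : Set (Boundary N)) : IsConvex (conv S) := by
  intro u hu w hw v hv
  by_cases h1 : u = v
  · rwa [← h1]
  by_cases h2 : w = v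
  · rwa [← h2]
  obtain ⟨ξ, hξ, e1⟩ := exists_bdir_eq_dir hu h1
  obtain ⟨ζ, hζ, e2⟩ := exists_bdir_eq_dir hw h2
  refine ⟨ξ, hξ, ζ, hζ, fun h => hv ?_⟩
  rw [← e1, ← e2]
  exact congrArg some h

theorem dir_ray {ξ : Boundary N} {i n : ℕ} (h : i < n) :
    dir (ray ξ i) (ray ξ n) = some (ξ.1 i) := by
  obtain ⟨k, rfl⟩ : ∃ k, n = i + (k + 1) := ⟨n - i - 1, by omega⟩
  clear h
  induction k generalizing i with
  | zero =>
    have := (isFlow_dir (ray ξ (i + 1)) (ray ξ i) (ξ.1 i)).2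
    refine this ?_
    change dir (ray ξ (i + 1)) (ray ξ (i + 1)) ≠ _
    rw [dir_eq_none.2 rfl]; simp
  | succ k ih =>
    have := (isFlow_dir (ray ξ (i + (k + 1 + 1))) (ray ξ i) (ξ.1 i)).2
    refine this ?_
    change dir (ray ξ (i + 1)) _ ≠ _
    rw [show i + (k + 1 + 1) = i + 1 + (k + 1) by ring, ih]
    simpa using ξ.2 i

theorem convergesTo_ray (ξ : Boundary N) : ConvergesTo (ray ξ) ξ := by
  rw [convergesTo_iff]
  intro k
  filter_upwards [Filter.eventually_ge_atTop k] with n hn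
  exact ofFn_prefix_iff.2 (toWord_of_dir fun i hi => dir_ray (hi.trans_le hn))

theorem eq_of_bdir_ray {ξ ζ : Boundary N} (h : ∀ n, bdir (ray ξ n) ζ = ξ.1 n) : ζ = ξ := by
  have key : ∀ n i, ((ray ξ n)⁻¹ • ζ).1 i = ζ.1 (n + i) := by
    intro n
    induction n with
    | zero => intro i; simp [ray]
    | succ n ih =>
      intro i
      have h0 : ((ray ξ n)⁻¹ • ζ).1 0 = ξ.1 n := h n
      rw [ray, mul_inv_rev, mul_smul, ← letter_invLetter, letter_smul]
      simp only [letterMul, h0, invLetter_invLetter, if_true, ih]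
      rw [show n + 1 + i = n + (i + 1) by ring]
  refine Subtype.ext (funext fun n => ?_)
  rw [← h n, ← add_zero n, ← key]; rfl

/-- A second point `ζ` of `S` branches off the ray at some vertex. From every later vertex `ζ` is
seen backwards and `ξ` forwards. -/
theorem exists_ray_mem_conv {S : Set (Boundary N)} (hS : S.Nontrivial) {ξ : Boundary N}
    (hξ : ξ ∈ S) : ∃ m, ∀ n ≥ m, ray ξ n ∈ conv S := by
  obtain ⟨ζ, hζ, hne⟩ := hS.exists_ne ξ
  obtain ⟨m, hm⟩ : ∃ m, bdir (ray ξ m) ζ ≠ ξ.1 m := by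
    by_contra! h
    exact hne (eq_of_bdir_ray h)
  refine ⟨m, fun n hn => ⟨ξ, hξ, ζ, hζ, ?_⟩⟩
  change bdir (ray ξ n) ξ ≠ bdir (ray ξ n) ζ
  rw [bdir_ray]
  induction n, hn using Nat.le_induction with
  | base => exact hm.symm
  | succ n hn ih =>
    have := (isFlow_bdir ζ (ray ξ n) (ξ.1 n)).not.1 (by simpa using ih.symm)
    simp only [not_not, ne_eq, Option.some.injEq] at this
    change ξ.1 (n + 1) ≠ bdir (ray ξ n * letter (ξ.1 n)) ζ
    rw [this]
    exact ξ.2 n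

theorem conv_nonempty {S : Set (Boundary N)} : (conv S).Nonempty ↔ S.Nontrivial := by
  constructor
  · rintro ⟨v, ξ, hξ, ζ, hζ, hne⟩
    exact ⟨ξ, hξ, ζ, hζ, fun h => hne (by rw [h])⟩
  · intro hS
    obtain ⟨ξ, hξ⟩ := hS.nonempty
    obtain ⟨m, hm⟩ := exists_ray_mem_conv hS hξ
    exact ⟨_, hm m le_rfl⟩

/-! ### Cocompact actions -/

/-- The set `T` is covered by finitely many orbits of `L`. -/
def IsCocompact (L : Subgroup (FreeGroup (Fin N))) (T : Set (FreeGroup (Fin N))) : Prop :=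
  ∃ B : Set (FreeGroup (Fin N)), B.Finite ∧ ∀ v ∈ T, ∃ l ∈ L, ∃ b ∈ B, v = l * b

theorem IsCocompact.mono {L : Subgroup (FreeGroup (Fin N))} {T T' : Set (FreeGroup (Fin N))}
    (h : IsCocompact L T) (hT : T' ⊆ T) : IsCocompact L T' := by
  obtain ⟨B, hB, h⟩ := h
  exact ⟨B, hB, fun v hv => h v (hT hv)⟩

theorem mem_conjSubgroup {G : Type*} [Group G] {g x : G} {H : Subgroup G} :
    x ∈ conjSubgroup g H ↔ g⁻¹ * x * g ∈ H := by
  simp only [conjSubgroup, Subgroup.mem_map]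
  constructor
  · rintro ⟨y, hy, rfl⟩
    simpa [mul_assoc] using hy
  · intro h
    exact ⟨_, h, by simp [mul_assoc]⟩

theorem conjSubgroup_inv_conjSubgroup {G : Type*} [Group G] (g : G) (H : Subgroup G) :
    conjSubgroup g⁻¹ (conjSubgroup g H) = H := by
  ext x
  simp [mem_conjSubgroup, mul_assoc]

theorem toConjAct_smul_eq {G : Type*} [Group G] (g : G) (H : Subgroup G) :
    ConjAct.toConjAct g • H = conjSubgroup g H := by
  ext x
  rw [mem_conjSubgroup, Subgroup.mem_pointwise_smul_iff_inv_smul_mem, ← map_inv,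
    ConjAct.toConjAct_smul, inv_inv]

theorem IsCocompact.conj {L : Subgroup (FreeGroup (Fin N))} {T : Set (FreeGroup (Fin N))}
    (h : IsCocompact L T) (g : FreeGroup (Fin N)) : IsCocompact (conjSubgroup g L) (g • T) := by
  obtain ⟨B, hB, h⟩ := h
  refine ⟨(g * ·) '' B, hB.image _, ?_⟩
  rintro _ ⟨v, hv, rfl⟩
  obtain ⟨l, hl, b, hb, rfl⟩ := h v hv
  exact ⟨g * l * g⁻¹, mem_conjSubgroup.2 (by simpa [mul_assoc] using hl), g * b, ⟨b, hb, rfl⟩,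
    by simp [mul_assoc]⟩

/-- Since the action is free, the vertices in `Lb ∩ L'b'` lie in a single orbit of `L ⊓ L'`; one
representative for each pair `(b, b')` suffices. This takes the place of Howson's theorem. -/
theorem IsCocompact.inter {L L' : Subgroup (FreeGroup (Fin N))}
    {T T' : Set (FreeGroup (Fin N))} (h : IsCocompact L T) (h' : IsCocompact L' T') :
    IsCocompact (L ⊓ L') (T ∩ T') := by
  classical
  obtain ⟨B, hB, h⟩ := h
  obtain ⟨B', hB', h'⟩ := h'
  let P : FreeGroup (Fin N) × FreeGroup (Fin N) → FreeGroup (Fin N) → Prop :=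
    fun p v => v ∈ T ∩ T' ∧ v * p.1⁻¹ ∈ L ∧ v * p.2⁻¹ ∈ L'
  let r : FreeGroup (Fin N) × FreeGroup (Fin N) → FreeGroup (Fin N) :=
    fun p => if hp : ∃ v, P p v then hp.choose else 1
  refine ⟨r '' (B ×ˢ B'), (hB.prod hB').image r, ?_⟩
  rintro v ⟨hv, hv'⟩
  obtain ⟨l, hl, b, hb, e⟩ := h v hv
  obtain ⟨l', hl', b', hb', e'⟩ := h' v hv'
  have hP : P (b, b') v := ⟨⟨hv, hv'⟩, by simpa [e] using hl, by simpa [e'] using hl'⟩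
  have hr : P (b, b') (r (b, b')) := by
    have hex : ∃ v, P (b, b') v := ⟨v, hP⟩
    simp only [r, dif_pos hex]
    exact hex.choose_spec
  refine ⟨v * (r (b, b'))⁻¹, ⟨?_, ?_⟩, r (b, b'), ⟨(b, b'), ⟨hb, hb'⟩, rfl⟩, by simp⟩
  · simpa [mul_assoc] using L.mul_mem hP.2.1 (L.inv_mem hr.2.1)
  · simpa [mul_assoc] using L'.mul_mem hP.2.2 (L'.inv_mem hr.2.2)

/-- The `L`-orbit of `m⁻¹v` determines the coset `mL` because the action is free, and `T` meets only
finitely many orbits. -/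
theorem IsCocompact.relIndex_ne_zero {L M : Subgroup (FreeGroup (Fin N))}
    {T : Set (FreeGroup (Fin N))} (h : IsCocompact L T) (hT : T.Nonempty)
    (hM : ∀ m ∈ M, ∀ v ∈ T, m * v ∈ T) : L.relIndex M ≠ 0 := by
  obtain ⟨B, hB, h⟩ := h
  obtain ⟨v, hv⟩ := hT
  have hex : ∀ m : M, ∃ b ∈ B, ∃ l ∈ L, (m : FreeGroup (Fin N)) = v * b⁻¹ * l := by
    intro m
    obtain ⟨l, hl, b, hb, e⟩ := h _ (hM m⁻¹ (M.inv_mem m.2) v hv)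
    refine ⟨b, hb, l⁻¹, L.inv_mem hl, ?_⟩
    rw [inv_mul_eq_iff_eq_mul] at e
    rw [e]; group
  choose b hb l hl e using hex
  have : Finite B := hB
  have hfin : Finite (M ⧸ L.subgroupOf M) := by
    refine Finite.of_injective (fun q => (⟨b q.out, hb _⟩ : B)) fun q q' hq => ?_
    have hq' : b q.out = b q'.out := congrArg Subtype.val hq
    rw [← q.out_eq', ← q'.out_eq']
    refine QuotientGroup.eq.2 ?_
    rw [Subgroup.mem_subgroupOf]
    push_cast
    rw [e q.out, e q'.out, hq']
    simpa [mul_assoc] using L.mul_mem (L.inv_mem (hl q.out)) (hl q'.out)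
  exact Subgroup.index_ne_zero_of_finite

/-! ### Limit sets -/

theorem limitSet_mono {L H : Subgroup (FreeGroup (Fin N))} (h : L ≤ H) :
    limitSet L ⊆ limitSet H := by
  rintro ξ ⟨f, hf, ht⟩
  exact ⟨f, fun n => h (hf n), ht⟩

theorem limitSet_bot : limitSet (⊥ : Subgroup (FreeGroup (Fin N))) = ∅ := by
  refine Set.eq_empty_of_forall_notMem fun ξ hξ => ?_
  rw [mem_limitSet] at hξ
  obtain ⟨h, hh, h1⟩ := hξ 1
  rw [Subgroup.mem_bot] at hh
  simpa [hh] using h1 0 (by omega)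

theorem isClosed_limitSet (H : Subgroup (FreeGroup (Fin N))) : IsClosed (limitSet H) := by
  have e : limitSet H = ⋂ k : ℕ, (fun (ξ : Boundary N) (i : Fin k) => ξ.1 i) ⁻¹'
      {u | ∃ h ∈ H, ∀ i : Fin k, h.toWord[(i : ℕ)]? = some (u i)} := by
    ext ξ
    simp only [mem_limitSet, Set.mem_iInter, Set.mem_preimage, Set.mem_ofPred_eq, Fin.forall_iff]
  rw [e]
  refine isClosed_iInter fun k => (isClosed_discrete _).preimage ?_
  exact continuous_pi fun i => (continuous_apply (i : ℕ)).comp continuous_subtype_val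

/-- The sequences `g * h n` and `g * h n * g⁻¹` differ by a bounded perturbation. -/
theorem smul_limitSet_subset (g : FreeGroup (Fin N)) (H : Subgroup (FreeGroup (Fin N))) :
    g • limitSet H ⊆ limitSet (conjSubgroup g H) := by
  rintro _ ⟨ξ, hξ, rfl⟩
  obtain ⟨h, hH, hc⟩ := mem_limitSet_iff_convergesTo.1 hξ
  refine mem_limitSet_iff_convergesTo.2 ⟨fun n => g * h n * g⁻¹, fun n => ?_, ?_⟩
  · exact mem_conjSubgroup.2 (by simpa [mul_assoc] using hH n)
  · exact (hc.mul_left g).mul_right (Set.finite_singleton g⁻¹) fun n => rfl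

theorem smul_limitSet (g : FreeGroup (Fin N)) (H : Subgroup (FreeGroup (Fin N))) :
    g • limitSet H = limitSet (conjSubgroup g H) := by
  refine (smul_limitSet_subset g H).antisymm ?_
  rw [Set.subset_smul_set_iff]
  exact (smul_limitSet_subset _ _).trans (by rw [conjSubgroup_inv_conjSubgroup])

theorem conjSubgroup_of_mem {G : Type*} [Group G] {H : Subgroup G} {h : G} (hh : h ∈ H) :
    conjSubgroup h H = H := by
  ext x
  rw [mem_conjSubgroup, H.mul_mem_cancel_right hh, H.mul_mem_cancel_left (H.inv_mem hh)]

theorem smul_limitSet_of_mem {H : Subgroup (FreeGroup (Fin N))} {h : FreeGroup (Fin N)}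
    (hh : h ∈ H) : h • limitSet H = limitSet H := by
  rw [smul_limitSet, conjSubgroup_of_mem hh]

theorem limitSet_subset_of_relIndex {L H : Subgroup (FreeGroup (Fin N))}
    (h : L.relIndex H ≠ 0) : limitSet H ⊆ limitSet L := by
  intro ξ hξ
  obtain ⟨f, hf, hc⟩ := mem_limitSet_iff_convergesTo.1 hξ
  have hfin : Finite (H ⧸ L.subgroupOf H) := by
    have : (L.subgroupOf H).FiniteIndex := ⟨h⟩
    infer_instance
  -- The coset of the inverse is taken so that `f n` times its representative lies in `L`; there are
  -- only finitely many representatives.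
  let q : ℕ → H ⧸ L.subgroupOf H := fun n => QuotientGroup.mk ⟨(f n)⁻¹, H.inv_mem (hf n)⟩
  refine mem_limitSet_iff_convergesTo.2
    ⟨fun n => f n * (q n).out, fun n => ?_, hc.mul_right
      (Set.finite_range fun p : H ⧸ L.subgroupOf H => (p.out : FreeGroup (Fin N)))
      fun n => ⟨q n, rfl⟩⟩
  have := QuotientGroup.eq.1 ((q n).out_eq').symm
  rw [Subgroup.mem_subgroupOf] at this
  simpa using this

theorem limitSet_eq_of_commensurable {L H : Subgroup (FreeGroup (Fin N))}
    (h : Subgroup.Commensurable L H) : limitSet L = limitSet H :=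
  (limitSet_subset_of_relIndex h.2).antisymm (limitSet_subset_of_relIndex h.1)

theorem flatten_replicate_getElem? {α : Type*} {c : List α} {m i : ℕ}
    (hi : i < m * c.length) :
    (List.replicate m c).flatten[i]? = (c)[i % c.length]? := by
  induction m generalizing i with
  | zero => simp at hi
  | succ m ih =>
    rw [List.replicate_succ, List.flatten_cons]
    by_cases h : i < c.length
    · rw [List.getElem?_append_left h, Nat.mod_eq_of_lt h]
    · push Not at h
      rw [List.getElem?_append_right h, ih (by rw [add_mul] at hi; omega), ← Nat.mod_eq_sub_mod h]

/-- The point is the periodic word `ccc…`: for cyclically reduced `c` no cancellation occurs in the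
powers. -/
theorem exists_mem_limitSet_zpowers {c : List (Fin N × Bool)} (hc : c ≠ [])
    (hr : FreeGroup.IsCyclicallyReduced c) :
    ∃ ξ ∈ limitSet (Subgroup.zpowers (FreeGroup.mk c)), some (ξ.1 0) = c.head? := by
  have hpos : 0 < c.length := List.length_pos_iff.2 hc
  have hw : ∀ m, (FreeGroup.mk c ^ m).toWord = (List.replicate m c).flatten := by
    intro m
    rw [FreeGroup.toWord_pow, FreeGroup.toWord_mk, hr.isReduced.reduce_eq,
      (hr.flatten_replicate m).isReduced.reduce_eq]
  let f : ℕ → Fin N × Bool := fun n => (c)[n % c.length]'(Nat.mod_lt _ hpos)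
  have hf : ∀ m i, i < m * c.length → (FreeGroup.mk c ^ m).toWord[i]? = some (f i) := by
    intro m i hi
    rw [hw, flatten_replicate_getElem? hi]
    exact List.getElem?_eq_getElem _
  have hred : ∀ n, f (n + 1) ≠ invLetter (f n) := by
    intro n hn
    have h1 := hf (n + 2) n (by nlinarith)
    have h2 := hf (n + 2) (n + 1) (by nlinarith)
    rw [List.getElem?_eq_some_iff] at h1 h2
    obtain ⟨l1, e1⟩ := h1
    obtain ⟨l2, e2⟩ := h2
    have := List.isChain_iff_getElem.1 (FreeGroup.isReduced_toWord (x := FreeGroup.mk c ^ (n + 2)))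
      n (by omega)
    rw [e1, e2, hn] at this
    simp [invLetter] at this
  refine ⟨⟨f, hred⟩, mem_limitSet.2 fun k => ⟨FreeGroup.mk c ^ k,
    Subgroup.npow_mem_zpowers _ _, fun i hi => hf k i (by nlinarith)⟩, ?_⟩
  rw [List.head?_eq_getElem?]
  simp [f]

/-- The periodic words of `c` and `c⁻¹` start with the first letter of `c` and the inverse of its
last letter. These differ because `c` is cyclically reduced. -/
theorem nontrivial_limitSet_zpowers {c : List (Fin N × Bool)} (hc : c ≠ [])
    (hr : FreeGroup.IsCyclicallyReduced c) :
    (limitSet (Subgroup.zpowers (FreeGroup.mk c))).Nontrivial := by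
  obtain ⟨ξ, hξ, h0⟩ := exists_mem_limitSet_zpowers hc hr
  have hr' : FreeGroup.IsCyclicallyReduced (FreeGroup.invRev c) := by
    refine ⟨?_, ?_⟩
    · have : (FreeGroup.mk c)⁻¹.toWord = FreeGroup.invRev c := by
        rw [FreeGroup.toWord_inv, FreeGroup.toWord_mk, hr.isReduced.reduce_eq]
      rw [← this]
      exact FreeGroup.isReduced_toWord
    · simp only [FreeGroup.invRev, List.getLast?_reverse, List.head?_reverse, List.head?_map,
        List.getLast?_map, Option.mem_def, Option.map_eq_some_iff]
      rintro _ ⟨a, ha, rfl⟩ _ ⟨b, hb, rfl⟩ h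
      have := hr.2 b hb a ha h.symm
      simp [this]
  obtain ⟨ζ, hζ, h1⟩ := exists_mem_limitSet_zpowers (c := FreeGroup.invRev c)
    (by simpa [FreeGroup.invRev] using hc) hr'
  rw [← FreeGroup.inv_mk, Subgroup.zpowers_inv] at hζ
  refine ⟨ξ, hξ, ζ, hζ, ?_⟩
  rintro rfl
  rw [FreeGroup.invRev, List.head?_reverse, List.getLast?_map] at h1
  obtain ⟨y, hy, hy'⟩ := Option.map_eq_some_iff.1 h1.symm
  have := hr.2 y hy (ξ.1 0) h0.symm (by rw [← hy'])
  rw [← hy'] at this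
  simp at this

theorem nontrivial_limitSet {H : Subgroup (FreeGroup (Fin N))} (hH : H ≠ ⊥) :
    (limitSet H).Nontrivial := by
  obtain ⟨h, hh, h1⟩ := H.bot_or_exists_ne_one.resolve_left hH
  have hconj := FreeGroup.reduceCyclically.conj_conjugator_reduceCyclically h.toWord
  set u := FreeGroup.reduceCyclically.conjugator h.toWord
  set c := FreeGroup.reduceCyclically h.toWord with hcdef
  have hr : FreeGroup.IsCyclicallyReduced c :=
    FreeGroup.reduceCyclically.isCyclicallyReduced FreeGroup.isReduced_toWord
  have he : h = FreeGroup.mk u * FreeGroup.mk c * (FreeGroup.mk u)⁻¹ := by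
    rw [FreeGroup.inv_mk, FreeGroup.mul_mk, FreeGroup.mul_mk, hconj, FreeGroup.mk_toWord]
  have hc : c ≠ [] := by
    intro hc
    rw [hc, ← FreeGroup.one_eq_mk, mul_one, mul_inv_cancel] at he
    exact h1 he
  have hsub : FreeGroup.mk u • limitSet (Subgroup.zpowers (FreeGroup.mk c)) ⊆ limitSet H := by
    rw [smul_limitSet]
    refine limitSet_mono ?_
    rw [conjSubgroup, MonoidHom.map_zpowers, Subgroup.zpowers_le]
    rw [he] at hh
    exact hh
  exact ((nontrivial_limitSet_zpowers hc hr).image (MulAction.injective _)).mono hsub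

theorem mul_mem_conv_limitSet {H : Subgroup (FreeGroup (Fin N))} {h v : FreeGroup (Fin N)}
    (hh : h ∈ H) (hv : v ∈ conv (limitSet H)) : h * v ∈ conv (limitSet H) := by
  rw [← smul_limitSet_of_mem hh, mem_conv_smul]
  simpa using hv

/-- A hull vertex separates two limit points, hence two elements of `H`; up to translation by `H` it
lies on a geodesic from `1` to an element of `H`. Such geodesics are covered by `H`-translates of
the geodesics from `1` to the generators and their inverses. -/
theorem isCocompact_conv_limitSet {H : Subgroup (FreeGroup (Fin N))} (hH : H.FG) :
    IsCocompact H (conv (limitSet H)) := by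
  obtain ⟨S, rfl⟩ := hH
  set H := Subgroup.closure (S : Set (FreeGroup (Fin N)))
  let B : Set (FreeGroup (Fin N)) := (⋃ y ∈ S, {w | dir w 1 ≠ dir w y}) ∪
    ⋃ y ∈ S, {w | dir w 1 ≠ dir w y⁻¹}
  have hB : B.Finite := (S.finite_toSet.biUnion fun y _ => finite_dir_ne y).union
    (S.finite_toSet.biUnion fun y _ => finite_dir_ne y⁻¹)
  have step : ∀ y ∈ H, {w | dir w 1 ≠ dir w y} ⊆ B → ∀ h,
      (∀ v, dir v 1 ≠ dir v h → ∃ l ∈ H, ∃ b ∈ B, v = l * b) →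
      ∀ v, dir v 1 ≠ dir v (y * h) → ∃ l ∈ H, ∃ b ∈ B, v = l * b := by
    intro y hy hyB h ih v hv
    by_cases hvy : dir v 1 = dir v y
    · rw [hvy] at hv
      nth_rw 1 [← mul_one y] at hv
      rw [dir_mul_left, dir_mul_left] at hv
      obtain ⟨l, hl, b, hb, e⟩ := ih _ hv
      exact ⟨y * l, H.mul_mem hy hl, b, hb, by rw [mul_assoc, ← e, mul_inv_cancel_left]⟩
    · exact ⟨1, H.one_mem, v, hyB hvy, (one_mul v).symm⟩
  have key : ∀ h ∈ H, ∀ v, dir v 1 ≠ dir v h → ∃ l ∈ H, ∃ b ∈ B, v = l * b := by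
    intro h hh
    induction hh using Subgroup.closure_induction_left with
    | one => intro v hv; exact absurd rfl hv
    | mul_left x hx y hy ih =>
      refine step x (Subgroup.subset_closure hx) (fun w hw => Or.inl ?_) y ih
      exact Set.mem_iUnion₂.2 ⟨x, hx, hw⟩
    | inv_mul_cancel x hx y hy ih =>
      refine step x⁻¹ (H.inv_mem (Subgroup.subset_closure hx)) (fun w hw => Or.inr ?_) y ih
      exact Set.mem_iUnion₂.2 ⟨x, hx, hw⟩
  refine ⟨B, hB, ?_⟩
  rintro v ⟨ξ, hξ, ζ, hζ, hne⟩
  obtain ⟨f, hf, hc⟩ := mem_limitSet_iff_convergesTo.1 hξ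
  obtain ⟨f', hf', hc'⟩ := mem_limitSet_iff_convergesTo.1 hζ
  obtain ⟨n, hn, hn'⟩ := ((hc v).and (hc' v)).exists
  have hd : dir v (f n) ≠ dir v (f' n) := by
    rw [hn, hn']
    exact fun h => hne (Option.some_injective _ h)
  rw [← mul_inv_cancel_left (f n) (f' n)] at hd
  nth_rw 1 [← mul_one (f n)] at hd
  rw [dir_mul_left, dir_mul_left] at hd
  obtain ⟨l, hl, b, hb, e⟩ := key _ (H.mul_mem (H.inv_mem (hf n)) (hf' n)) _ hd
  exact ⟨f n * l, H.mul_mem (hf n) hl, b, hb, by rw [mul_assoc, ← e, mul_inv_cancel_left]⟩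

/-- The ray to a common limit point eventually runs in both hulls. There `H ⊓ K` acts cocompactly,
so its elements follow the ray up to a bounded error. -/
theorem limitSet_inf {H K : Subgroup (FreeGroup (Fin N))} (hH : H ≠ ⊥) (hK : K ≠ ⊥)
    (hHc : IsCocompact H (conv (limitSet H))) (hKc : IsCocompact K (conv (limitSet K))) :
    limitSet H ∩ limitSet K = limitSet (H ⊓ K) := by
  refine Set.Subset.antisymm ?_
    (Set.subset_inter (limitSet_mono inf_le_left) (limitSet_mono inf_le_right))
  rintro ξ ⟨hξ, hξ'⟩
  obtain ⟨m, hm⟩ := exists_ray_mem_conv (nontrivial_limitSet hH) hξ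
  obtain ⟨m', hm'⟩ := exists_ray_mem_conv (nontrivial_limitSet hK) hξ'
  obtain ⟨B, hB, h⟩ := hHc.inter hKc
  have hex : ∀ n, ∃ l ∈ H ⊓ K, ∃ b ∈ B, ray ξ (n + max m m') = l * b := fun n =>
    h _ ⟨hm _ (le_add_left (le_max_left _ _)), hm' _ (le_add_left (le_max_right _ _))⟩
  choose l hl b hb e using hex
  refine mem_limitSet_iff_convergesTo.2 ⟨l, hl, ?_⟩
  have hc : ConvergesTo (fun n => ray ξ (n + max m m')) ξ := fun v =>
    (Filter.tendsto_add_atTop_nat _).eventually (convergesTo_ray ξ v)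
  have := hc.mul_right hB.inv (c := fun n => (b n)⁻¹) fun n => by simpa using hb n
  simpa [e] using this

/-- If `g` fixes the limit set, `H` and its conjugate act cocompactly on the same hull. Both then
have finite index in the stabilizer of the limit set, so they are commensurable. -/
theorem mem_commensurator_iff {H : Subgroup (FreeGroup (Fin N))} (hH : H ≠ ⊥)
    (hc : IsCocompact H (conv (limitSet H))) {g : FreeGroup (Fin N)} :
    g ∈ Subgroup.Commensurable.commensurator H ↔ g • limitSet H = limitSet H := by
  rw [Subgroup.Commensurable.commensurator_mem_iff, toConjAct_smul_eq]
  constructor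
  · intro h
    rw [smul_limitSet, limitSet_eq_of_commensurable h]
  · intro h
    have hne : (conv (limitSet H)).Nonempty := conv_nonempty.2 (nontrivial_limitSet hH)
    let M := MulAction.stabilizer (FreeGroup (Fin N)) (limitSet H)
    have hM : ∀ m ∈ M, ∀ v ∈ conv (limitSet H), m * v ∈ conv (limitSet H) := by
      intro m hm v hv
      rw [← MulAction.mem_stabilizer_iff.1 hm, mem_conv_smul]
      simpa using hv
    have h1 : H ≤ M := fun x hx => smul_limitSet_of_mem hx
    have h2 : conjSubgroup g H ≤ M := by
      intro x hx
      have := smul_limitSet_of_mem hx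
      rwa [← smul_limitSet, h] at this
    have hc' := hc.conj g
    rw [← conv_smul, h] at hc'
    exact ⟨fun h0 => hc'.relIndex_ne_zero hne hM (Subgroup.relIndex_eq_zero_of_le_right h1 h0),
      fun h0 => hc.relIndex_ne_zero hne hM (Subgroup.relIndex_eq_zero_of_le_right h2 h0)⟩

theorem le_commensurator (H : Subgroup (FreeGroup (Fin N))) :
    H ≤ Subgroup.Commensurable.commensurator H := by
  intro h hh
  rw [Subgroup.Commensurable.commensurator_mem_iff, toConjAct_smul_eq, conjSubgroup_of_mem hh]

theorem relIndex_commensurator_ne_zero {H : Subgroup (FreeGroup (Fin N))} (hH : H ≠ ⊥)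
    (hc : IsCocompact H (conv (limitSet H))) :
    H.relIndex (Subgroup.Commensurable.commensurator H) ≠ 0 := by
  refine hc.relIndex_ne_zero (conv_nonempty.2 (nontrivial_limitSet hH)) fun m hm v hv => ?_
  rw [← (mem_commensurator_iff hH hc).1 hm, mem_conv_smul]
  simpa using hv

theorem limitSet_commensurator {H : Subgroup (FreeGroup (Fin N))} (hH : H ≠ ⊥)
    (hc : IsCocompact H (conv (limitSet H))) :
    limitSet (Subgroup.Commensurable.commensurator H) = limitSet H :=
  (limitSet_subset_of_relIndex (relIndex_commensurator_ne_zero hH hc)).antisymm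
    (limitSet_mono (le_commensurator H))

/-! ### The Euler characteristic of the quotient of a tree by a free action -/

theorem IsConvex.induction {T : Set (FreeGroup (Fin N))} (hT : IsConvex T)
    {P : FreeGroup (Fin N) → Prop}
    (hP : ∀ v x, v ∈ T → v * letter x ∈ T → P v → P (v * letter x))
    {u w : FreeGroup (Fin N)} (hu : u ∈ T) (hw : w ∈ T) (h : P u) : P w := by
  obtain ⟨g, rfl⟩ : ∃ g, w = u * g := ⟨u⁻¹ * w, by simp⟩
  obtain ⟨L, hL⟩ : ∃ L, g.toWord = L := ⟨_, rfl⟩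
  induction L generalizing g u with
  | nil =>
    rw [FreeGroup.toWord_eq_nil_iff] at hL
    rwa [hL, mul_one]
  | cons x L ih =>
    obtain ⟨g', rfl, h', hx⟩ := exists_of_toWord_eq_cons hL
    rw [← mul_assoc] at hw ⊢
    have hm : u * letter x ∈ T := by
      refine hT _ hu _ hw _ ?_
      have h1 : dir (u * letter x) u = some (invLetter x) := by
        simp [dir, ← letter_invLetter, toWord_letter]
      have h2 : dir (u * letter x) (u * letter x * g') = L.head? := by
        rw [dir, inv_mul_cancel_left, h']
      rw [h1, h2]
      exact hx.symm
    exact ih hm (hP u x hu hm h) g' hw h'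

theorem IsConvex.eq_of_forall_edge {A : Type*} {T : Set (FreeGroup (Fin N))} (hT : IsConvex T)
    {f : FreeGroup (Fin N) → A}
    (hf : ∀ v a, v ∈ T → v * FreeGroup.of a ∈ T → f (v * FreeGroup.of a) = f v)
    {u w : FreeGroup (Fin N)} (hu : u ∈ T) (hw : w ∈ T) : f w = f u := by
  refine hT.induction (P := fun v => f v = f u) ?_ hu hw rfl
  rintro v ⟨a, _ | _⟩ hv hvx h
  · have e : letter (a, false) = (FreeGroup.of a)⁻¹ := rfl
    rw [e] at hvx ⊢
    have := hf _ a hvx (by simpa using hv)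
    rw [inv_mul_cancel_right] at this
    rw [← this, h]
  · exact (hf v a hv hvx).trans h

theorem isConvex_univ : IsConvex (Set.univ : Set (FreeGroup (Fin N))) :=
  fun _ _ _ _ _ _ => trivial

/-- Every function on the edges of the Cayley tree is the gradient of a function on the vertices. -/
theorem exists_potential {A : Type*} [CommGroup A] (C : FreeGroup (Fin N) → Fin N → A) :
    ∃ f : FreeGroup (Fin N) → A, ∀ v a, f (v * FreeGroup.of a) = f v * C v a := by
  -- A free group acts by arbitrary permutations attached to its generators, so path independence
  -- needs no proof. Generators move backwards along edges, so that `v⁻¹` carries `(1, 1)` along the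
  -- path from `1` to `v` while accumulating the values of `C`.
  let step : Fin N → Equiv.Perm (FreeGroup (Fin N) × A) := fun a =>
    { toFun := fun p => (p.1 * (FreeGroup.of a)⁻¹, p.2 * (C (p.1 * (FreeGroup.of a)⁻¹) a)⁻¹)
      invFun := fun p => (p.1 * FreeGroup.of a, p.2 * C p.1 a)
      left_inv := fun p => by simp
      right_inv := fun p => by simp }
  let Φ : FreeGroup (Fin N) →* Equiv.Perm (FreeGroup (Fin N) × A) := FreeGroup.lift step
  have hinv : ∀ a p, Φ (FreeGroup.of a)⁻¹ p = (p.1 * FreeGroup.of a, p.2 * C p.1 a) := by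
    intro a p
    rw [map_inv]
    simp only [Φ, FreeGroup.lift_apply_of]
    rfl
  have h1 : ∀ v, (Φ v⁻¹ (1, 1)).1 = v := by
    intro v
    have : ∀ v p, (Φ v p).1 = p.1 * v⁻¹ := by
      intro v
      induction v using FreeGroup.induction_on with
      | C1 => simp
      | of a => intro p; simp [Φ, step]
      | inv_of a _ => intro p; rw [hinv]; simp
      | mul x y hx hy => intro p; rw [map_mul, Equiv.Perm.mul_apply, hx, hy]; simp [mul_assoc]
    simpa using this v⁻¹ (1, 1)
  refine ⟨fun v => (Φ v⁻¹ (1, 1)).2, fun v a => ?_⟩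
  simp only [mul_inv_rev, map_mul, Equiv.Perm.mul_apply]
  rw [hinv, h1]

/-- The cosets corresponding to the orbits of vertices of `T` under `L`. -/
def vertexCosets (L : Subgroup (FreeGroup (Fin N))) (T : Set (FreeGroup (Fin N))) :
    Set (FreeGroup (Fin N) ⧸ L) :=
  {q | q.out⁻¹ ∈ T}

/-- The cosets corresponding to the orbits under `L` of the edges of `T` with label `a`. -/
def edgeCosets (L : Subgroup (FreeGroup (Fin N))) (T : Set (FreeGroup (Fin N))) (a : Fin N) :
    Set (FreeGroup (Fin N) ⧸ L) :=
  {q | q.out⁻¹ ∈ T ∧ q.out⁻¹ * FreeGroup.of a ∈ T}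

section Euler

variable {L : Subgroup (FreeGroup (Fin N))} {T : Set (FreeGroup (Fin N))}

/-- The left orbit `Lv` corresponds to the coset `v⁻¹L`. This product is the element of `L` that
takes the representative `out⁻¹` of the orbit to `v`. -/
theorem mul_out_mem (L : Subgroup (FreeGroup (Fin N))) (v : FreeGroup (Fin N)) :
    v * (QuotientGroup.mk v⁻¹ : FreeGroup (Fin N) ⧸ L).out ∈ L := by
  obtain ⟨l, hl⟩ := QuotientGroup.mk_out_eq_mul L v⁻¹
  rw [hl]
  simp

theorem mk_mul_inv {l : FreeGroup (Fin N)} (hl : l ∈ L) (v : FreeGroup (Fin N)) :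
    (QuotientGroup.mk (l * v)⁻¹ : FreeGroup (Fin N) ⧸ L) = QuotientGroup.mk v⁻¹ := by
  rw [mul_inv_rev]
  exact QuotientGroup.mk_mul_of_mem _ (L.inv_mem hl)

theorem out_inv_mem (hL : ∀ l ∈ L, ∀ v ∈ T, l * v ∈ T) {v : FreeGroup (Fin N)} :
    (QuotientGroup.mk v⁻¹ : FreeGroup (Fin N) ⧸ L).out⁻¹ ∈ T ↔ v ∈ T := by
  have h := mul_out_mem L v
  constructor
  · intro hv
    simpa using hL _ h _ hv
  · intro hv
    simpa using hL _ (L.inv_mem h) _ hv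

theorem out_inv_mul_mem (hL : ∀ l ∈ L, ∀ v ∈ T, l * v ∈ T) {v g : FreeGroup (Fin N)} :
    (QuotientGroup.mk v⁻¹ : FreeGroup (Fin N) ⧸ L).out⁻¹ * g ∈ T ↔ v * g ∈ T := by
  have h := mul_out_mem L v
  constructor
  · intro hv
    simpa [mul_assoc] using hL _ h _ hv
  · intro hv
    simpa [mul_assoc] using hL _ (L.inv_mem h) _ hv

theorem finite_setOf_out_inv_mul_mem (hc : IsCocompact L T) (v : FreeGroup (Fin N)) :
    {q : FreeGroup (Fin N) ⧸ L | q.out⁻¹ * v ∈ T}.Finite := by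
  obtain ⟨B, hB, h⟩ := hc
  refine (hB.image fun b => (QuotientGroup.mk (b * v⁻¹)⁻¹ : FreeGroup (Fin N) ⧸ L)).subset ?_
  intro q hq
  obtain ⟨l, hl, b, hb, e⟩ := h _ hq
  refine ⟨b, hb, ?_⟩
  change (QuotientGroup.mk (b * v⁻¹)⁻¹ : FreeGroup (Fin N) ⧸ L) = q
  rw [← mk_mul_inv hl, ← mul_assoc, ← e, mul_inv_cancel_right, inv_inv, QuotientGroup.out_eq']

theorem finite_vertexCosets (hc : IsCocompact L T) : (vertexCosets L T).Finite := by
  have := finite_setOf_out_inv_mul_mem hc 1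
  simp only [mul_one] at this
  exact this

theorem finite_edgeCosets (hc : IsCocompact L T) (a : Fin N) : (edgeCosets L T a).Finite :=
  (finite_vertexCosets hc).subset fun _ h => h.1

/-- The functions on `T` which are equivariant with respect to some homomorphism from `L` to `A`,
extended trivially to all vertices. -/
def EquivariantFunctions (L : Subgroup (FreeGroup (Fin N))) (T : Set (FreeGroup (Fin N)))
    (A : Type) [CommGroup A] : Type :=
  {p : (L →* A) × (FreeGroup (Fin N) → A) //
    (∀ v ∉ T, p.2 v = 1) ∧ ∀ l : L, ∀ v ∈ T, p.2 (l * v) = p.1 l * p.2 v}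

variable {A : Type} [CommGroup A]

/-- First count of the equivariant functions: as `L` acts freely, the homomorphism and the values at
orbit representatives can be prescribed independently. -/
theorem bijective_restrict_vertexCosets (hL : ∀ l ∈ L, ∀ v ∈ T, l * v ∈ T) :
    Function.Bijective fun p : EquivariantFunctions L T A =>
      ((p.1.1, fun q => p.1.2 q.1.out⁻¹) : (L →* A) × (vertexCosets L T → A)) := by
  classical
  constructor
  · rintro ⟨⟨φ, f⟩, hf, hf'⟩ ⟨⟨ψ, g⟩, hg, hg'⟩ h
    simp only [Prod.mk.injEq] at h hf hf' hg hg'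
    obtain ⟨rfl, h⟩ := h
    refine Subtype.ext (Prod.ext rfl (funext fun v => ?_))
    change f v = g v
    by_cases hv : v ∈ T
    · have hr := (out_inv_mem hL).2 hv
      have e1 := hf' ⟨_, mul_out_mem L v⟩ _ hr
      have e2 := hg' ⟨_, mul_out_mem L v⟩ _ hr
      have e3 := congrFun h ⟨_, hr⟩
      simp only [mul_inv_cancel_right] at e1 e2 e3
      rw [e1, e2, e3]
    · rw [hf v hv, hg v hv]
  · rintro ⟨φ, c⟩
    let c' : FreeGroup (Fin N) ⧸ L → A := fun q => if h : q ∈ vertexCosets L T then c ⟨q, h⟩ else 1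
    refine ⟨⟨(φ, fun v => if v ∈ T then φ ⟨_, mul_out_mem L v⟩ * c' (QuotientGroup.mk v⁻¹) else 1),
      fun v hv => if_neg hv, fun l v hv => ?_⟩, ?_⟩
    · simp only [hL l l.2 v hv, hv, if_true]
      rw [← mul_assoc, ← map_mul]
      congr 2
      · refine Subtype.ext ?_
        simp only [mk_mul_inv l.2, Subgroup.coe_mul, mul_assoc]
      · rw [mk_mul_inv l.2]
    · refine Prod.ext rfl (funext fun q => ?_)
      have hq : q.1.out⁻¹ ∈ T := q.2
      simp only [hq, if_true, inv_inv, QuotientGroup.out_eq', inv_mul_cancel]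
      have h1 : φ ⟨1, L.one_mem⟩ = 1 := map_one φ
      rw [h1, one_mul]
      simp only [c', dif_pos q.2]

/-- Second count: a function is determined by one value and its increments along edges. The
increments are `L`-invariant and otherwise arbitrary because a tree has no cycles; the homomorphism
is recovered from them. -/
theorem bijective_gradient (hL : ∀ l ∈ L, ∀ v ∈ T, l * v ∈ T) (hT : IsConvex T)
    {v₀ : FreeGroup (Fin N)} (hv₀ : v₀ ∈ T) :
    Function.Bijective fun p : EquivariantFunctions L T A =>
      ((p.1.2 v₀, fun e => (p.1.2 e.2.1.out⁻¹)⁻¹ * p.1.2 (e.2.1.out⁻¹ * FreeGroup.of e.1)) :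
        A × ((Σ a, edgeCosets L T a) → A)) := by
  classical
  constructor
  · rintro ⟨⟨φ, f⟩, hf, hf'⟩ ⟨⟨ψ, g⟩, hg, hg'⟩ h
    simp only [Prod.mk.injEq] at h hf hf' hg hg'
    obtain ⟨h0, h⟩ := h
    have hfg : ∀ v ∈ T, f v = g v := by
      intro v hv
      have : f v / g v = f v₀ / g v₀ := by
        refine hT.eq_of_forall_edge (f := fun v => f v / g v) (fun v a hv hva => ?_) hv₀ hv
        have hr := (out_inv_mem hL).2 hv
        have hra := (out_inv_mul_mem hL).2 hva
        have e : (f _)⁻¹ * f _ = (g _)⁻¹ * g _ := congrFun h ⟨a, _, hr, hra⟩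
        have e1 := hf' ⟨_, mul_out_mem L v⟩ _ hr
        have e2 := hg' ⟨_, mul_out_mem L v⟩ _ hr
        have e3 := hf' ⟨_, mul_out_mem L v⟩ _ hra
        have e4 := hg' ⟨_, mul_out_mem L v⟩ _ hra
        simp only [mul_assoc, mul_inv_cancel_left, mul_inv_cancel, mul_one] at e1 e2 e3 e4
        simp only [e1, e2, e3, e4]
        rw [mul_div_mul_comm, mul_div_mul_comm]
        congr 1
        rw [inv_mul_eq_iff_eq_mul] at e
        rw [div_eq_div_iff_mul_eq_mul]
        exact e ▸ (by rw [mul_assoc, mul_comm _ (g _), mul_inv_cancel_left])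
      rw [h0, div_self', div_eq_one] at this
      exact this
    have hφ : φ = ψ := by
      ext l
      have e1 := hf' l v₀ hv₀
      rw [hfg _ (hL l l.2 v₀ hv₀), hg' l v₀ hv₀, hfg _ hv₀] at e1
      exact (mul_right_cancel e1).symm
    subst hφ
    refine Subtype.ext (Prod.ext rfl (funext fun v => ?_))
    by_cases hv : v ∈ T
    · exact hfg v hv
    · exact (hf v hv).trans (hg v hv).symm
  · rintro ⟨α, c⟩
    -- The increments are extended by `1` to edges outside `T`, so that they can be integrated over
    -- the whole Cayley tree.
    let C : FreeGroup (Fin N) ⧸ L → Fin N → A :=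
      fun q a => if h : q ∈ edgeCosets L T a then c ⟨a, q, h⟩ else 1
    obtain ⟨f₀, hf₀⟩ := exists_potential fun v a => C (QuotientGroup.mk v⁻¹) a
    let f₁ : FreeGroup (Fin N) → A := fun v => f₀ v * (f₀ v₀)⁻¹ * α
    have hf₁ : ∀ v a, f₁ (v * FreeGroup.of a) = f₁ v * C (QuotientGroup.mk v⁻¹) a := by
      intro v a
      simp only [f₁, hf₀]
      simp only [mul_assoc, mul_comm, mul_left_comm]
    -- Invariant increments make this quotient constant on the tree; the constants form the required
    -- homomorphism.
    have hconst : ∀ l ∈ L, ∀ v, f₁ (l * v) / f₁ v = f₁ l / f₁ 1 := by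
      intro l hl v
      have := isConvex_univ.eq_of_forall_edge (f := fun v => f₁ (l * v) / f₁ v) (u := 1) (w := v)
        (fun v a _ _ => by
          simp only [← mul_assoc, hf₁, mk_mul_inv hl, mul_div_mul_right_eq_div]) trivial trivial
      simpa using this
    let φ : L →* A :=
      { toFun := fun l => f₁ l / f₁ 1
        map_one' := by simp
        map_mul' := fun l m => by
          have := hconst l l.2 m
          rw [Subgroup.coe_mul, ← this, div_mul_div_cancel] }
    refine ⟨⟨(φ, fun v => if v ∈ T then f₁ v else 1), fun v hv => if_neg hv, fun l v hv => ?_⟩, ?_⟩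
    · simp only [hL l l.2 v hv, hv, if_true]
      rw [← div_eq_iff_eq_mul]
      exact hconst l l.2 v
    · refine Prod.ext ?_ (funext fun e => ?_)
      · simp [hv₀, f₁]
      · obtain ⟨a, q, hq⟩ := e
        simp only [hq.1, hq.2, if_true, hf₁, inv_mul_cancel_left, inv_inv, QuotientGroup.out_eq']
        simp only [C, dif_pos hq]

/-- With values in the two-element group `ℤˣ`, the two counts of equivariant functions read `2 · 2^E
= 2^rank · 2^V`. Finiteness of the rank also follows, since only finitely many homomorphisms to `ℤˣ`
are possible. -/
theorem sum_card_edgeCosets_add_one (hL : ∀ l ∈ L, ∀ v ∈ T, l * v ∈ T) (hT : IsConvex T)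
    (hne : T.Nonempty) (hc : IsCocompact L T) :
    Finite (IsFreeGroup.Generators L) ∧ ∑ a, (edgeCosets L T a).ncard + 1 =
      (vertexCosets L T).ncard + Nat.card (IsFreeGroup.Generators L) := by
  obtain ⟨v₀, hv₀⟩ := hne
  have : Finite (vertexCosets L T) := finite_vertexCosets hc
  have : ∀ a, Finite (edgeCosets L T a) := finite_edgeCosets hc
  have b1 := bijective_restrict_vertexCosets (A := ℤˣ) hL
  have b2 := bijective_gradient (A := ℤˣ) hL hT hv₀
  have hW : Finite (EquivariantFunctions L T ℤˣ) := Finite.of_injective _ b2.1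
  have hprod : Finite ((L →* ℤˣ) × (vertexCosets L T → ℤˣ)) := Finite.of_surjective _ b1.2
  have hHom : Finite (L →* ℤˣ) := Finite.of_surjective _
    (Prod.fst_surjective (β := vertexCosets L T → ℤˣ))
  let e : (IsFreeGroup.Generators L → ℤˣ) ≃ (L →* ℤˣ) := IsFreeGroup.lift
  have hfun : Finite (IsFreeGroup.Generators L → ℤˣ) := Finite.of_equiv _ e.symm
  have hgen : Finite (IsFreeGroup.Generators L) := by
    classical
    refine Finite.of_injective
      (fun x => (Function.update 1 x (-1) : IsFreeGroup.Generators L → ℤˣ)) fun x y hxy => ?_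
    by_contra hne
    have := congrFun hxy x
    simp only [Function.update_self, Function.update_of_ne hne, Pi.one_apply] at this
    exact absurd this (by decide)
  refine ⟨hgen, ?_⟩
  have h1 := (Nat.card_eq_of_bijective _ b2).symm.trans (Nat.card_eq_of_bijective _ b1)
  have h2 : Nat.card ℤˣ = 2 := by simp
  rw [Nat.card_prod, Nat.card_prod, ← Nat.card_congr e, Nat.card_fun, Nat.card_fun, Nat.card_fun, h2,
    Nat.card_sigma, ← pow_succ', ← pow_add] at h1
  have h3 := Nat.pow_right_injective (le_refl 2) h1
  simp only [Nat.card_coe_set_eq] at h3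
  rw [h3, add_comm]

theorem card_generators_bot :
    Nat.card (IsFreeGroup.Generators (⊥ : Subgroup (FreeGroup (Fin N)))) = 0 := by
  have : IsEmpty (IsFreeGroup.Generators (⊥ : Subgroup (FreeGroup (Fin N)))) := by
    refine ⟨fun x => ?_⟩
    let f : (⊥ : Subgroup (FreeGroup (Fin N))) →* ℤˣ := IsFreeGroup.lift fun _ => -1
    have h : f (IsFreeGroup.of x) = -1 := IsFreeGroup.lift_of _ _
    rw [Subsingleton.elim (IsFreeGroup.of x) 1, map_one] at h
    exact absurd h (by decide)
  exact Nat.card_of_isEmpty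

theorem card_generators_pos (hL : L ≠ ⊥) [Finite (IsFreeGroup.Generators L)] :
    0 < Nat.card (IsFreeGroup.Generators L) := by
  by_contra h
  have h0 : Nat.card (IsFreeGroup.Generators L) = 0 := by omega
  have hemp : IsEmpty (IsFreeGroup.Generators L) := by
    rcases Nat.card_eq_zero.1 h0 with h | h
    · exact h
    · exact absurd ‹Finite (IsFreeGroup.Generators L)› (not_finite_iff_infinite.2 h)
  refine hL ((Subgroup.eq_bot_iff_forall _).2 fun l hl => ?_)
  have : (IsFreeGroup.toFreeGroup L) ⟨l, hl⟩ = (IsFreeGroup.toFreeGroup L) 1 :=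
    Subsingleton.elim _ _
  exact congrArg Subtype.val ((IsFreeGroup.toFreeGroup L).injective this)

/-- For nontrivial `L` the rank is positive, so the truncated subtraction in `reducedRank` is exact.
-/
theorem reducedRank_eq (hL1 : L ≠ ⊥) (hL : ∀ l ∈ L, ∀ v ∈ T, l * v ∈ T) (hT : IsConvex T)
    (hne : T.Nonempty) (hc : IsCocompact L T) :
    (reducedRank L : ℝ) = ∑ a, ((edgeCosets L T a).ncard : ℝ) - (vertexCosets L T).ncard := by
  obtain ⟨hfin, h⟩ := sum_card_edgeCosets_add_one hL hT hne hc
  have hpos := card_generators_pos hL1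
  have : reducedRank L + (vertexCosets L T).ncard = ∑ a, (edgeCosets L T a).ncard := by
    rw [reducedRank]; omega
  rw [eq_sub_iff_add_eq]
  exact_mod_cast this

end Euler

/-! ### Sums of Dirac measures -/

open Classical in
theorem diracAt_apply (S : Set (Boundary N)) (U : Set (CSpace N)) :
    diracAt S U = if ∃ C ∈ U, (C.1 : Set (Boundary N)) = S then 1 else 0 := by
  rw [diracAt]
  split_ifs with h h' h'
  · obtain ⟨C, hC, rfl⟩ := h'
    rw [Measure.dirac_apply]
    exact Set.indicator_of_mem hC _
  · rw [Measure.dirac_apply]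
    exact Set.indicator_of_notMem (fun hm => h' ⟨_, hm, rfl⟩) _
  · obtain ⟨C, hC, rfl⟩ := h'
    exact absurd ⟨C.1.isCompact.isClosed, C.2⟩ h
  · rfl

theorem diracAt_coe (C : CSpace N) : diracAt (C.1 : Set (Boundary N)) = Measure.dirac C := by
  rw [diracAt, dif_pos ⟨C.1.isCompact.isClosed, C.2⟩]
  rfl

/-- The sum of the Dirac measures at the members of a family of sets. -/
def sumDirac {ι : Type*} (S : ι → Set (Boundary N)) : Measure (CSpace N) :=
  Measure.sum fun i => diracAt (S i)

section SumDirac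

variable {ι : Type*} [Countable ι] {S : ι → Set (Boundary N)}

theorem tsum_ite_eq_encard {α : Type*} (p : α → Prop) [DecidablePred p] :
    ∑' i, (if p i then 1 else 0 : ENNReal) = {i | p i}.encard := by
  rw [← ENNReal.tsum_set_one, tsum_subtype {i | p i} fun _ => (1 : ENNReal)]
  refine tsum_congr fun i => ?_
  simp [Set.indicator_apply]

/-- For infinite sets the default values agree: both sides are `0`. -/
theorem encard_toReal {α : Type*} (s : Set α) : (s.encard : ENNReal).toReal = s.ncard := by
  by_cases h : s.Finite
  · rw [← h.cast_ncard_eq]; simp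
  · rw [Set.Infinite.encard_eq h, Set.Infinite.ncard h]; simp

/-- As the family is countable and points are measurable, this holds for every `U`; cylinders need
no measurability check. -/
theorem sumDirac_apply (S : ι → Set (Boundary N)) (U : Set (CSpace N)) :
    sumDirac S U = {i | ∃ C ∈ U, (C.1 : Set (Boundary N)) = S i}.encard := by
  classical
  rw [sumDirac, Measure.sum_apply_of_countable, ← tsum_ite_eq_encard]
  exact tsum_congr fun i => diracAt_apply _ _

theorem sumDirac_real (hS : ∀ i, IsClosed (S i)) (P : Set (Boundary N) → Prop)
    (hP : ∀ s, P s → s.Nontrivial) :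
    (sumDirac S).real {C | P C.1} = {i | P (S i)}.ncard := by
  rw [measureReal_def, sumDirac_apply, encard_toReal]
  congr 2
  ext i
  constructor
  · rintro ⟨C, hC, e⟩
    change P (S i)
    rw [← e]
    exact hC
  · intro h
    exact ⟨⟨⟨S i, (hS i).isCompact⟩, hP _ h⟩, h, rfl⟩

/-- The condition says that the set meets two different open shadows seen from `v`, which is open in
the Vietoris topology. -/
theorem isOpen_mem_conv (v : FreeGroup (Fin N)) :
    IsOpen {C : Hyperspace N | v ∈ conv (C : Set (Boundary N))} := by
  have e : {C : Hyperspace N | v ∈ conv (C : Set (Boundary N))} =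
      ⋃ x, ⋃ y, ⋃ _ : x ≠ y, {C : Hyperspace N | ((C : Set (Boundary N)) ∩ {ξ | bdir v ξ = x}).Nonempty} ∩
        {C : Hyperspace N | ((C : Set (Boundary N)) ∩ {ξ | bdir v ξ = y}).Nonempty} := by
    ext C
    simp only [Set.mem_ofPred_eq, mem_conv, Set.mem_iUnion, Set.mem_inter_iff]
    constructor
    · rintro ⟨ξ, hξ, ζ, hζ, hne⟩
      exact ⟨_, _, hne, ⟨ξ, hξ, rfl⟩, ζ, hζ, rfl⟩
    · rintro ⟨x, y, hne, ⟨ξ, hξ, rfl⟩, ζ, hζ, rfl⟩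
      exact ⟨ξ, hξ, ζ, hζ, hne⟩
  have ho : ∀ x, IsOpen {ξ : Boundary N | bdir v ξ = x} := by
    intro x
    have hc : Continuous fun ξ : Boundary N => bdir v ξ :=
      ((continuous_apply 0).comp continuous_subtype_val).comp (boundaryAction N v⁻¹).continuous
    exact (isOpen_discrete {x}).preimage hc
  rw [e]
  exact isOpen_iUnion fun x => isOpen_iUnion fun y => isOpen_iUnion fun _ =>
    (Compacts.isOpen_inter_nonempty_of_isOpen (ho x)).inter
      (Compacts.isOpen_inter_nonempty_of_isOpen (ho y))

theorem isOpen_nontrivial :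
    IsOpen {C : Hyperspace N | (C : Set (Boundary N)).Nontrivial} := by
  have e : {C : Hyperspace N | (C : Set (Boundary N)).Nontrivial} =
      ⋃ v, {C : Hyperspace N | v ∈ conv (C : Set (Boundary N))} := by
    ext C
    simp only [Set.mem_ofPred_eq, Set.mem_iUnion, ← conv_nonempty]
    rfl
  rw [e]
  exact isOpen_iUnion isOpen_mem_conv

theorem aemeasurable_sumDirac {β : Type*} [MeasurableSpace β] (f : CSpace N → β) :
    AEMeasurable f (sumDirac S) := by
  rw [sumDirac, aemeasurable_sum_measure_iff]
  intro i
  rw [diracAt]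
  split_ifs
  · exact aemeasurable_dirac
  · exact aemeasurable_zero_measure

theorem coe_translate (g : FreeGroup (Fin N)) (C : CSpace N) :
    ((translate g C).1 : Set (Boundary N)) = g • (C.1 : Set (Boundary N)) := by
  rw [translate, Compacts.coe_map]; rfl

theorem map_translate_sumDirac (g : FreeGroup (Fin N)) :
    (sumDirac S).map (translate g) = sumDirac fun i => g • S i := by
  ext U hU
  rw [Measure.map_apply_of_aemeasurable (aemeasurable_sumDirac _) hU, sumDirac_apply,
    sumDirac_apply]
  congr 3
  ext i
  constructor
  · rintro ⟨C, hC, e⟩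
    exact ⟨_, hC, by rw [coe_translate, e]⟩
  · rintro ⟨C, hC, e⟩
    have h : translate g (translate g⁻¹ C) = C := by
      refine Subtype.ext (SetLike.coe_injective ?_)
      rw [coe_translate, coe_translate, smul_inv_smul]
    exact ⟨translate g⁻¹ C, by rwa [Set.mem_preimage, h], by rw [coe_translate, e, inv_smul_smul]⟩

/-- Every point of `C_N` has a nonempty hull, so the open sets "the hull contains `v`" cover `C_N`.
A compact set lies in finitely many of them, each of finite mass. Invariance is a reindexing. -/
theorem isSubsetCurrent_sumDirac
    (hinv : ∀ g : FreeGroup (Fin N), ∃ e : ι ≃ ι, ∀ i, g • S i = S (e i))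
    (hfin : ∀ v, {i | v ∈ conv (S i)}.Finite) : IsSubsetCurrent (sumDirac S) := by
  constructor
  · intro g
    obtain ⟨e, he⟩ := hinv g
    rw [map_translate_sumDirac]
    ext U hU
    simp only [sumDirac, he, Measure.sum_apply _ hU]
    exact e.tsum_eq fun i => diracAt (S i) U
  · intro C hC
    obtain ⟨t, ht⟩ := hC.elim_finite_subcover
      (fun v => {D : CSpace N | v ∈ conv (D.1 : Set (Boundary N))})
      (fun v => (isOpen_mem_conv v).preimage continuous_subtype_val) fun D _ =>
        Set.mem_iUnion.2 (conv_nonempty.2 D.2)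
    refine (measure_mono ht).trans_lt ((measure_biUnion_finset_le _ _).trans_lt ?_)
    refine ENNReal.sum_lt_top.2 fun v _ => ?_
    rw [sumDirac_apply]
    have : {i | ∃ D ∈ {D : CSpace N | v ∈ conv (D.1 : Set (Boundary N))},
        (D.1 : Set (Boundary N)) = S i} ⊆ {i | v ∈ conv (S i)} := by
      rintro i ⟨D, hD, e⟩
      change v ∈ conv (S i)
      rw [← e]
      exact hD
    have h := (Set.encard_lt_top_iff.2 ((hfin v).subset this))
    exact ENat.toENNReal_lt_top.2 h

/-- If every point of `C` lay on one side of the edge, the end on the other side would see all of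
`C` in a single direction, across the edge. -/
theorem mem_edgeSCyl {a : Fin N} {C : CSpace N} :
    C ∈ edgeSCyl a ↔ 1 ∈ conv (C.1 : Set (Boundary N)) ∧
      FreeGroup.of a ∈ conv (C.1 : Set (Boundary N)) := by
  have key : ∀ ξ : Boundary N,
      bdir (FreeGroup.of a) ξ ≠ invLetter (a, true) ↔ ξ.1 0 = (a, true) := by
    intro ξ
    have := isFlow_bdir ξ 1 (a, true)
    have e : (1 : FreeGroup (Fin N)) * letter (a, true) = FreeGroup.of a := one_mul _
    rw [e] at this
    simp only [Option.some.injEq, ne_eq] at this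
    rw [ne_eq, ← this, bdir, inv_one, one_smul]
  have h1 : ∀ ξ : Boundary N, bdir 1 ξ = ξ.1 0 := by
    intro ξ; rw [bdir, inv_one, one_smul]
  constructor
  · rintro ⟨⟨ξ, hξ, hx⟩, ζ, hζ, hz⟩
    refine ⟨mem_conv.2 ⟨ξ, hξ, ζ, hζ, ?_⟩, mem_conv.2 ⟨ξ, hξ, ζ, hζ, fun h => ?_⟩⟩
    · rw [h1, h1, hx]; exact hz.symm
    · rw [← key] at hx
      exact hz ((key ζ).1 (h ▸ hx))
  · rintro ⟨h, h'⟩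
    obtain ⟨ξ, hξ, ζ, hζ, hne⟩ := mem_conv.1 h
    obtain ⟨ξ', hξ', ζ', hζ', hne'⟩ := mem_conv.1 h'
    rw [h1, h1] at hne
    constructor
    · by_contra! hc
      have e1 := not_not.1 ((key ξ').not.2 (hc _ hξ'))
      have e2 := not_not.1 ((key ζ').not.2 (hc _ hζ'))
      exact hne' (e1.trans e2.symm)
    · by_contra! hc
      exact hne ((hc _ hξ).trans (hc _ hζ).symm)

theorem vertexFunctional_sumDirac (hS : ∀ i, IsClosed (S i)) :
    vertexFunctional (sumDirac S) = {i | 1 ∈ conv (S i)}.ncard :=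
  sumDirac_real hS (fun s => 1 ∈ conv s) fun _ h => conv_nonempty.1 ⟨_, h⟩

theorem real_edgeSCyl_sumDirac (hS : ∀ i, IsClosed (S i)) (a : Fin N) :
    (sumDirac S).real (edgeSCyl a) =
      {i | 1 ∈ conv (S i) ∧ FreeGroup.of a ∈ conv (S i)}.ncard := by
  rw [← sumDirac_real hS (fun s => 1 ∈ conv s ∧ FreeGroup.of a ∈ conv s)
    fun _ h => conv_nonempty.1 ⟨_, h.1⟩]
  congr 1
  ext C
  exact mem_edgeSCyl

theorem prod_sumDirac {ι κ : Type*} [Countable κ] (x : ι → CSpace N) (y : κ → CSpace N) :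
    (sumDirac fun i => ((x i).1 : Set (Boundary N))).prod
      (sumDirac fun j => ((y j).1 : Set (Boundary N))) =
      Measure.sum fun p : ι × κ => Measure.dirac (x p.1, y p.2) := by
  simp only [sumDirac, diracAt_coe]
  rw [Measure.prod_sum]
  simp only [Measure.dirac_prod_dirac]

theorem prod_sumDirac_apply {κ : Type*} [Countable κ] (x : ι → CSpace N) (y : κ → CSpace N)
    (U : Set (CSpace N × CSpace N)) :
    (sumDirac fun i => ((x i).1 : Set (Boundary N))).prod
      (sumDirac fun j => ((y j).1 : Set (Boundary N))) U =
      {p : ι × κ | (x p.1, y p.2) ∈ U}.encard := by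
  classical
  rw [prod_sumDirac, Measure.sum_apply_of_countable, ← tsum_ite_eq_encard]
  refine tsum_congr fun p => ?_
  rw [Measure.dirac_apply, Set.indicator_apply]
  rfl

/-- Pairs whose intersection has fewer than two points drop out on both sides, since `diracAt`
vanishes there. -/
theorem interCurrent_sumDirac {κ : Type*} [Countable κ] (x : ι → CSpace N) (y : κ → CSpace N) :
    interCurrent (sumDirac fun i => ((x i).1 : Set (Boundary N)))
      (sumDirac fun j => ((y j).1 : Set (Boundary N))) =
      sumDirac fun p : ι × κ =>
        ((x p.1).1 : Set (Boundary N)) ∩ ((y p.2).1 : Set (Boundary N)) := by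
  have hemb : MeasurableEmbedding (Subtype.val : CSpace N → Hyperspace N) :=
    MeasurableEmbedding.subtype_coe isOpen_nontrivial.measurableSet
  ext U hU
  have hae : AEMeasurable (interMap (N := N)) (Measure.sum fun p : ι × κ =>
      Measure.dirac (x p.1, y p.2)) := by
    rw [aemeasurable_sum_measure_iff]
    exact fun i => aemeasurable_dirac
  rw [interCurrent, hemb.comap_apply, prod_sumDirac,
    Measure.map_apply_of_aemeasurable hae (hemb.measurableSet_image.2 hU), ← prod_sumDirac,
    prod_sumDirac_apply, sumDirac_apply]
  congr 3
  ext p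
  simp only [Set.mem_preimage, Set.mem_image, interMap]
  refine exists_congr fun C => and_congr_right fun _ => ?_
  rw [← SetLike.coe_set_eq, Compacts.coe_inf]

end SumDirac

/-! ### The counting current as a sum over cosets -/

section Counting

instance (H : Subgroup (FreeGroup (Fin N))) : Countable (FreeGroup (Fin N) ⧸ H) :=
  QuotientGroup.mk_surjective.countable

variable {H : Subgroup (FreeGroup (Fin N))}

theorem out_smul_limitSet (H : Subgroup (FreeGroup (Fin N))) (g : FreeGroup (Fin N)) :
    (QuotientGroup.mk g : FreeGroup (Fin N) ⧸ H).out • limitSet H = g • limitSet H := by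
  obtain ⟨h, hh⟩ := QuotientGroup.mk_out_eq_mul H g
  rw [hh, mul_smul, smul_limitSet_of_mem h.2]

theorem isClosed_smul_limitSet (H : Subgroup (FreeGroup (Fin N))) (g : FreeGroup (Fin N)) :
    IsClosed (g • limitSet H) := by
  rw [smul_limitSet]
  exact isClosed_limitSet _

theorem nontrivial_smul_limitSet (hH : H ≠ ⊥) (g : FreeGroup (Fin N)) :
    (g • limitSet H).Nontrivial :=
  (nontrivial_limitSet hH).image (MulAction.injective g)

/-- The translate of the limit set of `H` by a coset of `H`. -/
def limitPoint (hH : H ≠ ⊥) (q : FreeGroup (Fin N) ⧸ H) : CSpace N :=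
  ⟨⟨q.out • limitSet H, (isClosed_smul_limitSet H q.out).isCompact⟩,
    nontrivial_smul_limitSet hH q.out⟩

theorem conjSubgroup_mul {G : Type*} [Group G] (g h : G) (H : Subgroup G) :
    conjSubgroup (g * h) H = conjSubgroup g (conjSubgroup h H) := by
  ext x
  simp [mem_conjSubgroup, mul_assoc]

theorem counting_bot :
    counting (⊥ : Subgroup (FreeGroup (Fin N))) = 0 := if_pos rfl

/-- Conjugates of the commensurator correspond to its cosets. Each coset consists of `[Ĥ : H]`
cosets of `H`, all giving the same translate of the limit set, and this produces the multiplicity.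
-/
theorem counting_eq_sumDirac (hH : H ≠ ⊥) (hc : IsCocompact H (conv (limitSet H))) :
    counting H = sumDirac fun q : FreeGroup (Fin N) ⧸ H => q.out • limitSet H := by
  rw [counting, if_neg hH]
  set C := Subgroup.Commensurable.commensurator H
  have hC : limitSet C = limitSet H := limitSet_commensurator hH hc
  have hcoset : ∀ (a b : FreeGroup (Fin N)),
      conjSubgroup a C = conjSubgroup b C → (a : FreeGroup (Fin N) ⧸ C) = b := by
    intro a b hab
    have h : a • limitSet H = b • limitSet H := by
      rw [← hC, smul_limitSet, smul_limitSet, hab]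
    rw [QuotientGroup.eq]
    refine (mem_commensurator_iff hH hc).2 ?_
    rw [mul_smul, ← h, inv_smul_smul]
  let e₁ : FreeGroup (Fin N) ⧸ C ≃ Set.range fun g : FreeGroup (Fin N) => conjSubgroup g C :=
    Equiv.ofBijective (fun q => ⟨conjSubgroup q.out C, q.out, rfl⟩) (by
      constructor
      · intro q q' h
        have := hcoset _ _ (congrArg Subtype.val h)
        rwa [QuotientGroup.out_eq', QuotientGroup.out_eq'] at this
      · rintro ⟨_, g, rfl⟩
        refine ⟨QuotientGroup.mk g, Subtype.ext ?_⟩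
        obtain ⟨c, hc⟩ := QuotientGroup.mk_out_eq_mul C g
        change conjSubgroup (QuotientGroup.mk g : FreeGroup (Fin N) ⧸ C).out C = conjSubgroup g C
        rw [hc, conjSubgroup_mul, conjSubgroup_of_mem c.2])
  let e₂ := Subgroup.quotientEquivProdOfLE (le_commensurator H)
  have hrel : H.relIndex C ≠ 0 := relIndex_commensurator_ne_zero hH hc
  have : Finite (C ⧸ H.subgroupOf C) := by
    have : (H.subgroupOf C).FiniteIndex := ⟨hrel⟩
    infer_instance
  have hout : ∀ q : FreeGroup (Fin N) ⧸ H,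
      q.out • limitSet H = (e₂ q).1.out • limitSet H := by
    intro q
    have h1 : (e₂ q).1 = QuotientGroup.mk q.out := by
      nth_rw 1 [← q.out_eq']
      rfl
    rw [h1, ← hC, out_smul_limitSet]
  ext U hU
  rw [Measure.smul_apply, Measure.sum_apply _ hU, sumDirac, Measure.sum_apply _ hU,
    ← e₁.tsum_eq, ← e₂.symm.tsum_eq]
  have h2 : ∀ p, diracAt ((e₂.symm p).out • limitSet H) U =
      diracAt (p.1.out • limitSet H) U := by
    intro p
    rw [hout, e₂.apply_symm_apply]
  simp only [h2]
  refine Eq.trans ?_ (ENNReal.tsum_prod (f := fun (a : FreeGroup (Fin N) ⧸ C)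
    (_ : C ⧸ H.subgroupOf C) => diracAt (a.out • limitSet H) U)).symm
  have := Fintype.ofFinite (C ⧸ H.subgroupOf C)
  have hcard : H.relIndex C = Fintype.card (C ⧸ H.subgroupOf C) := Nat.card_eq_fintype_card
  simp only [tsum_fintype, Finset.sum_const, Finset.card_univ, ← hcard, nsmul_eq_mul]
  rw [ENNReal.tsum_mul_left]
  congr 1
  refine tsum_congr fun q => ?_
  rw [← hC, smul_limitSet]
  rfl

theorem finite_mem_conv_out_smul (hc : IsCocompact H (conv (limitSet H)))
    (v : FreeGroup (Fin N)) :
    {q : FreeGroup (Fin N) ⧸ H | v ∈ conv (q.out • limitSet H)}.Finite := by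
  simp only [mem_conv_smul]
  exact finite_setOf_out_inv_mul_mem hc v

theorem smul_out_smul_limitSet (g : FreeGroup (Fin N)) (q : FreeGroup (Fin N) ⧸ H) :
    g • q.out • limitSet H = (g • q).out • limitSet H := by
  have h : g • q = QuotientGroup.mk (g * q.out) := by
    nth_rw 1 [← q.out_eq']
    rfl
  rw [h, out_smul_limitSet, mul_smul]

theorem isSubsetCurrent_counting (hH : H ≠ ⊥) (hc : IsCocompact H (conv (limitSet H))) :
    IsSubsetCurrent (counting H) := by
  rw [counting_eq_sumDirac hH hc]
  refine isSubsetCurrent_sumDirac (fun g => ⟨MulAction.toPerm g, fun q => ?_⟩)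
    (finite_mem_conv_out_smul hc)
  exact smul_out_smul_limitSet g q

end Counting

/-! ### Pairs of cosets and double cosets -/

section DoubleCosets

variable {G : Type*} [Group G] {H K : Subgroup G}
  {rep : DoubleCoset.Quotient (H : Set G) K → G}

/-- The orbits of `G` on `G ⧸ H × G ⧸ K` are indexed by the double cosets, and the stabilizer of
the pair of cosets `(H, gK)` is `H ∩ gKg⁻¹`. -/
def sigmaEquivProd (hrep : ∀ d, DoubleCoset.mk H K (rep d) = d) :
    (Σ d : DoubleCoset.Quotient (H : Set G) K, G ⧸ (H ⊓ conjSubgroup (rep d) K)) ≃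
      (G ⧸ H) × (G ⧸ K) :=
  Equiv.ofBijective (fun p => (QuotientGroup.mk p.2.out, QuotientGroup.mk (p.2.out * rep p.1))) (by
    constructor
    · rintro ⟨d, z⟩ ⟨d', z'⟩ h
      simp only [Prod.mk.injEq] at h
      obtain ⟨h1, h2⟩ := h
      rw [QuotientGroup.eq] at h1 h2
      have hd : d = d' := by
        rw [← hrep d, ← hrep d', DoubleCoset.eq]
        exact ⟨_, H.inv_mem h1, _, h2, by group⟩
      subst hd
      congr 1
      rw [← z.out_eq', ← z'.out_eq']
      refine QuotientGroup.eq.2 ⟨h1, mem_conjSubgroup.2 ?_⟩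
      simpa [mul_assoc] using h2
    · rintro ⟨q, q'⟩
      obtain ⟨x, rfl⟩ := QuotientGroup.mk_surjective q
      obtain ⟨y, rfl⟩ := QuotientGroup.mk_surjective q'
      obtain ⟨h, hh, k, hk, e⟩ := (DoubleCoset.eq H K (x⁻¹ * y) _).1
        (hrep (DoubleCoset.mk H K (x⁻¹ * y))).symm
      set d := DoubleCoset.mk H K (x⁻¹ * y)
      obtain ⟨l, hl⟩ := QuotientGroup.mk_out_eq_mul (H ⊓ conjSubgroup (rep d) K) (x * h⁻¹)
      -- Replacing `x` by `x * h⁻¹` keeps the coset `xH`, and `x * h⁻¹ * rep d` then differs from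
      -- `y` by the right factor `k`.
      refine ⟨⟨d, QuotientGroup.mk (x * h⁻¹)⟩, Prod.ext ?_ ?_⟩
      · change (QuotientGroup.mk (QuotientGroup.mk (x * h⁻¹) : G ⧸ _).out : G ⧸ H) = _
        rw [hl, mul_assoc]
        exact QuotientGroup.mk_mul_of_mem _ (H.mul_mem (H.inv_mem hh) l.2.1)
      · change (QuotientGroup.mk ((QuotientGroup.mk (x * h⁻¹) : G ⧸ _).out * rep d) : G ⧸ K) = _
        rw [hl]
        have hl' := mem_conjSubgroup.1 l.2.2
        have e2 : x * h⁻¹ * l * rep d = y * (k * ((rep d)⁻¹ * l * rep d)) := by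
          have : y = x * h⁻¹ * rep d * k⁻¹ := by rw [e]; group
          rw [this]; group
        rw [e2]
        exact QuotientGroup.mk_mul_of_mem _ (K.mul_mem hk hl'))

theorem sigmaEquivProd_apply (hrep : ∀ d, DoubleCoset.mk H K (rep d) = d)
    (d : DoubleCoset.Quotient (H : Set G) K) (z : G ⧸ (H ⊓ conjSubgroup (rep d) K)) :
    sigmaEquivProd hrep ⟨d, z⟩ = (QuotientGroup.mk z.out, QuotientGroup.mk (z.out * rep d)) := rfl

end DoubleCosets

/-- This splits a finite count of pairs of cosets into a sum over double cosets; finiteness of `B`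
gives convergence. -/
theorem hasSum_ncard_fiber {D P : Type*} {X : D → Type*} (e : (Σ d, X d) ≃ P) {B : Set P}
    (hB : B.Finite) : HasSum (fun d => ({x | e ⟨d, x⟩ ∈ B}.ncard : ℝ)) B.ncard := by
  classical
  have hB' : (e ⁻¹' B).Finite := hB.preimage e.injective.injOn
  have hcard : B.ncard = hB'.toFinset.card := by
    rw [← Set.ncard_eq_toFinset_card _ hB', Set.ncard_preimage_of_injective_subset_range e.injective]
    simp [e.surjective.range_eq]
  have h1 : HasSum (fun p : Σ d, X d => if e p ∈ B then (1 : ℝ) else 0) B.ncard := by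
    have := hasSum_sum_of_ne_finset_zero (s := hB'.toFinset) (L := SummationFilter.unconditional _)
      (f := fun p : Σ d, X d => if e p ∈ B then (1 : ℝ) else 0) fun p hp => if_neg (by simpa using hp)
    convert this using 1
    rw [Finset.sum_congr rfl fun p hp => if_pos (by simpa using hp), hcard]
    simp
  refine h1.sigma fun d => ?_
  have hfin : {x | e ⟨d, x⟩ ∈ B}.Finite :=
    hB'.preimage (f := Sigma.mk d) sigma_mk_injective.injOn
  have := hasSum_sum_of_ne_finset_zero (s := hfin.toFinset) (L := SummationFilter.unconditional _)
    (f := fun x => if e ⟨d, x⟩ ∈ B then (1 : ℝ) else 0) fun p hp => if_neg (by simpa using hp)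
  convert this using 1
  rw [Finset.sum_congr rfl fun p hp => if_pos (by simpa using hp),
    Set.ncard_eq_toFinset_card _ hfin]
  simp

/-! ### Finite subtrees -/

theorem infinite_conv {S : Set (Boundary N)} (hS : S.Nontrivial) : (conv S).Infinite := by
  obtain ⟨ξ, hξ⟩ := hS.nonempty
  obtain ⟨m, hm⟩ := exists_ray_mem_conv hS hξ
  have hinj : Function.Injective (ray ξ) := by
    have hlt : ∀ i n, i < n → ray ξ i ≠ ray ξ n := by
      intro i n h he
      have := dir_ray (ξ := ξ) h
      rw [dir_eq_none.2 he] at this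
      simp at this
    intro i n h
    rcases lt_trichotomy i n with h' | h' | h'
    · exact absurd h (hlt _ _ h')
    · exact h'
    · exact absurd h.symm (hlt _ _ h')
  exact Set.infinite_of_injective_forall_mem
    (fun a b h => Nat.add_right_cancel (hinj h) : Function.Injective fun n => ray ξ (n + m))
    fun n => hm _ (by omega)

theorem IsConvex.connected {T : Set (FreeGroup (Fin N))} (hT : IsConvex T) (hne : T.Nonempty) :
    ((cayley N).induce T).Connected := by
  have : Nonempty T := hne.to_subtype
  refine ⟨fun ⟨u, hu⟩ ⟨w, hw⟩ => ?_⟩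
  refine hT.induction
    (P := fun v => ∀ hv : v ∈ T, ((cayley N).induce T).Reachable ⟨u, hu⟩ ⟨v, hv⟩) ?_ hu hw
    (fun _ => SimpleGraph.Reachable.refl _) hw
  intro v x hv hvx h _
  refine (h hv).trans (SimpleGraph.Adj.reachable ?_)
  rw [SimpleGraph.induce_adj, cayley, SimpleGraph.fromRel_adj]
  refine ⟨fun he => ?_, ?_⟩
  · have h1 : letter x = 1 := by simpa using he
    have := toWord_letter x
    rw [h1] at this
    simp at this
  · rcases x with ⟨a, _ | _⟩
    · right
      refine ⟨a, ?_⟩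
      have e : letter (a, false) = (FreeGroup.of a)⁻¹ := rfl
      change v = v * letter (a, false) * _
      rw [e, inv_mul_cancel_right]
    · exact Or.inl ⟨a, rfl⟩

/-- A nontrivial element that preserves a finite nonempty set would have finite order, but free
groups are torsion-free. -/
theorem eq_of_smul_eq_of_finite {T : Set (FreeGroup (Fin N))} (hT : T.Finite) (hne : T.Nonempty)
    {g h : FreeGroup (Fin N)} (e : g • T = h • T) : g = h := by
  obtain ⟨v, hv⟩ := hne
  have hm : (g⁻¹ * h) • T = T := by rw [mul_smul, ← e, inv_smul_smul]
  have hpow : ∀ n : ℕ, (g⁻¹ * h) ^ n * v ∈ T := by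
    intro n
    induction n with
    | zero => simpa
    | succ n ih =>
      rw [pow_succ', mul_assoc, ← hm]
      exact Set.smul_mem_smul_set ih
  by_contra hne
  have h1 : g⁻¹ * h ≠ 1 := by rwa [ne_eq, inv_mul_eq_one]
  refine hT.not_infinite (Set.infinite_of_injective_forall_mem
    (f := fun n : ℕ => (g⁻¹ * h) ^ n * v) (fun a b hab => ?_) hpow)
  have := mul_right_cancel hab
  exact injective_pow_iff_not_isOfFinOrder.2 (not_isOfFinOrder_of_isMulTorsionFree h1) this

/-- A translate of a finite convex set is the chosen representative of a class of based subtrees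
for exactly one translation. -/
theorem existsUnique_smul_eq_out {T : Set (FreeGroup (Fin N))} (hT : IsConvex T) (hfin : T.Finite)
    (hne : T.Nonempty) : ∃! g : FreeGroup (Fin N),
      ∃ q : Quotient (subtreeSetoid N), g • T = q.out.1 := by
  obtain ⟨v, hv⟩ := hne
  have hne : T.Nonempty := ⟨v, hv⟩
  let T' : BasedSubtree N := ⟨v⁻¹ • T, hfin.image _, ⟨v, hv, by simp⟩,
    (hT.smul v⁻¹).connected (hne.image _)⟩
  obtain ⟨g, hg⟩ : ∃ g : FreeGroup (Fin N), g • T'.1 = (⟦T'⟧ : Quotient (subtreeSetoid N)).out.1 :=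
    Setoid.symm (Quotient.mk_out (s := subtreeSetoid N) T')
  refine ⟨g * v⁻¹, ⟨_, by rw [← hg, mul_smul]⟩, ?_⟩
  rintro g' ⟨q, hq⟩
  have hqq : q = ⟦T'⟧ := by
    rw [← q.out_eq]
    refine Quotient.sound (s := subtreeSetoid N) ⟨v⁻¹ * g'⁻¹, ?_⟩
    rw [← hq, ← mul_smul, inv_mul_cancel_right]
  refine eq_of_smul_eq_of_finite hfin hne ?_
  rw [hq, hqq, ← hg, mul_smul]

/-- After the two sums are exchanged, each pair contributes to at most one class, since its
intersection of hulls is at most one chosen representative. -/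
theorem contractibleFunctional_sumDirac {ι κ : Type*} [Countable ι] [Countable κ] (x : ι → CSpace N)
    (y : κ → CSpace N) :
    contractibleFunctional (sumDirac fun i => ((x i).1 : Set (Boundary N)))
      (sumDirac fun j => ((y j).1 : Set (Boundary N))) =
    ({p : ι × κ | ∃ q : Quotient (subtreeSetoid N), conv ((x p.1).1 : Set (Boundary N)) ∩
        conv ((y p.2).1 : Set (Boundary N)) = q.out.1}.ncard : ℝ) := by
  classical
  rw [contractibleFunctional, ← encard_toReal]
  congr 1
  simp only [prod_sumDirac_apply, ← tsum_ite_eq_encard]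
  rw [ENNReal.tsum_comm]
  refine tsum_congr fun p => ?_
  split_ifs with h
  · obtain ⟨q, hq⟩ := h
    rw [tsum_eq_single q]
    · exact if_pos hq
    · intro q' hne
      refine if_neg fun hq' => hne ?_
      have : q'.out = q.out := Subtype.ext (hq'.symm.trans hq)
      rw [← q.out_eq, ← q'.out_eq, this]
  · rw [ENNReal.tsum_eq_zero]
    exact fun q => if_neg fun hq => h ⟨q, hq⟩

/-! ### The main theorem -/

section Main

variable {H K : Subgroup (FreeGroup (Fin N))}

theorem limitSet_inf_conj (hH : H ≠ ⊥) (hK : K ≠ ⊥) (hHc : IsCocompact H (conv (limitSet H)))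
    (hKc : IsCocompact K (conv (limitSet K))) (g : FreeGroup (Fin N)) :
    limitSet H ∩ g • limitSet K = limitSet (H ⊓ conjSubgroup g K) := by
  have hK' : conjSubgroup g K ≠ ⊥ := by
    rintro h
    have := nontrivial_smul_limitSet hK g
    rw [smul_limitSet, h, limitSet_bot] at this
    exact this.nonempty.ne_empty rfl
  rw [smul_limitSet]
  refine limitSet_inf hH hK' hHc ?_
  rw [← smul_limitSet, conv_smul]
  exact hKc.conj g

/-- The intersection of the convex hulls of the limit sets of `H` and `gKg⁻¹`. -/
def coreInter (H K : Subgroup (FreeGroup (Fin N))) (g : FreeGroup (Fin N)) :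
    Set (FreeGroup (Fin N)) :=
  conv (limitSet H) ∩ conv (g • limitSet K)

theorem isConvex_coreInter (g : FreeGroup (Fin N)) : IsConvex (coreInter H K g) :=
  (isConvex_conv _).inter (isConvex_conv _)

theorem isCocompact_coreInter (hHc : IsCocompact H (conv (limitSet H)))
    (hKc : IsCocompact K (conv (limitSet K))) (g : FreeGroup (Fin N)) :
    IsCocompact (H ⊓ conjSubgroup g K) (coreInter H K g) := by
  refine hHc.inter ?_
  rw [conv_smul]
  exact hKc.conj g

theorem mul_mem_coreInter {g l v : FreeGroup (Fin N)} (hl : l ∈ H ⊓ conjSubgroup g K)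
    (hv : v ∈ coreInter H K g) : l * v ∈ coreInter H K g := by
  refine ⟨mul_mem_conv_limitSet hl.1 hv.1, ?_⟩
  have := hv.2
  rw [smul_limitSet] at this ⊢
  exact mul_mem_conv_limitSet hl.2 this

theorem conv_limitSet_subset_coreInter (g : FreeGroup (Fin N)) :
    conv (limitSet (H ⊓ conjSubgroup g K)) ⊆ coreInter H K g := by
  refine Set.subset_inter (conv_mono (limitSet_mono inf_le_left)) (conv_mono ?_)
  rw [smul_limitSet]
  exact limitSet_mono inf_le_right

theorem isCocompact_conv_limitSet_inf (hHc : IsCocompact H (conv (limitSet H)))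
    (hKc : IsCocompact K (conv (limitSet K))) (g : FreeGroup (Fin N)) :
    IsCocompact (H ⊓ conjSubgroup g K) (conv (limitSet (H ⊓ conjSubgroup g K))) :=
  (isCocompact_coreInter hHc hKc g).mono (conv_limitSet_subset_coreInter g)

theorem setOf_one_mem_smul (L : Subgroup (FreeGroup (Fin N))) (T : Set (FreeGroup (Fin N))) :
    {z : FreeGroup (Fin N) ⧸ L | 1 ∈ z.out • T} = vertexCosets L T := by
  ext z
  simp [vertexCosets, Set.mem_smul_set_iff_inv_smul_mem]

theorem setOf_one_mem_smul_and (L : Subgroup (FreeGroup (Fin N))) (T : Set (FreeGroup (Fin N)))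
    (a : Fin N) :
    {z : FreeGroup (Fin N) ⧸ L | 1 ∈ z.out • T ∧ FreeGroup.of a ∈ z.out • T} =
      edgeCosets L T a := by
  ext z
  simp [edgeCosets, Set.mem_smul_set_iff_inv_smul_mem]

theorem reducedRank_bot : reducedRank (⊥ : Subgroup (FreeGroup (Fin N))) = 0 := by
  rw [reducedRank, card_generators_bot]

theorem vertexCosets_empty (L : Subgroup (FreeGroup (Fin N))) : vertexCosets L ∅ = ∅ := rfl

theorem edgeCosets_empty (L : Subgroup (FreeGroup (Fin N))) (a : Fin N) :
    edgeCosets L ∅ a = ∅ := by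
  ext z; simp [edgeCosets]

theorem reducedRank_eq_conv {L : Subgroup (FreeGroup (Fin N))}
    (hc : IsCocompact L (conv (limitSet L))) :
    ∑ a, ((edgeCosets L (conv (limitSet L)) a).ncard : ℝ) -
      (vertexCosets L (conv (limitSet L))).ncard = reducedRank L := by
  by_cases hL : L = ⊥
  · subst hL
    have h : conv (limitSet (⊥ : Subgroup (FreeGroup (Fin N)))) = ∅ := by
      rw [limitSet_bot, ← Set.not_nonempty_iff_eq_empty, conv_nonempty]
      exact Set.not_nontrivial_empty
    simp [h, vertexCosets_empty, edgeCosets_empty, reducedRank_bot]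
  · exact (reducedRank_eq hL (fun l hl v hv => mul_mem_conv_limitSet hl hv) (isConvex_conv _)
      (conv_nonempty.2 (nontrivial_limitSet hL)) hc).symm

/-- If `L` is nontrivial, `T` is infinite and the last count vanishes. If `L` is trivial, `T` is
empty or a finite tree; in the latter case exactly one translate is a chosen representative, and
this `1` cancels the Euler characteristic. -/
theorem reducedRank_eq_coreInter (hHc : IsCocompact H (conv (limitSet H)))
    (hKc : IsCocompact K (conv (limitSet K))) (g : FreeGroup (Fin N)) :
    ∑ a, ((edgeCosets (H ⊓ conjSubgroup g K) (coreInter H K g) a).ncard : ℝ) -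
      (vertexCosets (H ⊓ conjSubgroup g K) (coreInter H K g)).ncard +
      {z : FreeGroup (Fin N) ⧸ (H ⊓ conjSubgroup g K) | ∃ q : Quotient (subtreeSetoid N),
        z.out • coreInter H K g = q.out.1}.ncard = reducedRank (H ⊓ conjSubgroup g K) := by
  have hc := isCocompact_coreInter hHc hKc g
  have hinv : ∀ l ∈ H ⊓ conjSubgroup g K, ∀ v ∈ coreInter H K g, l * v ∈ coreInter H K g :=
    fun l hl v hv => mul_mem_coreInter hl hv
  have hconv : IsConvex (coreInter H K g) := isConvex_coreInter g
  have hsub := conv_limitSet_subset_coreInter (H := H) (K := K) g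
  generalize coreInter H K g = T at *
  generalize H ⊓ conjSubgroup g K = L at *
  by_cases hL : L = ⊥
  · subst hL
    rcases T.eq_empty_or_nonempty with rfl | hne
    · have h0 : {z : FreeGroup (Fin N) ⧸ (⊥ : Subgroup (FreeGroup (Fin N))) |
          ∃ q : Quotient (subtreeSetoid N),
            z.out • (∅ : Set (FreeGroup (Fin N))) = q.out.1} = ∅ := by
        refine Set.eq_empty_of_forall_notMem ?_
        rintro z ⟨q, hq⟩
        have := q.out.2.2.1
        rw [← hq, Set.smul_set_empty] at this
        exact this
      rw [h0]
      simp [vertexCosets_empty, edgeCosets_empty, reducedRank_bot]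
    · have hfin : T.Finite := by
        obtain ⟨B, hB, h⟩ := hc
        refine hB.subset fun v hv => ?_
        obtain ⟨l, hl, b, hb, rfl⟩ := h v hv
        rw [Subgroup.mem_bot] at hl
        simpa [hl] using hb
      obtain ⟨-, h⟩ := sum_card_edgeCosets_add_one hinv hconv hne hc
      obtain ⟨x, hx, huniq⟩ := existsUnique_smul_eq_out hconv hfin hne
      have h1 : {z : FreeGroup (Fin N) ⧸ (⊥ : Subgroup (FreeGroup (Fin N))) |
          ∃ q : Quotient (subtreeSetoid N), z.out • T = q.out.1} = {QuotientGroup.mk x} := by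
        ext z
        constructor
        · intro hz
          rw [Set.mem_singleton_iff, ← huniq _ hz, QuotientGroup.out_eq']
        · rintro rfl
          obtain ⟨l, hl⟩ := QuotientGroup.mk_out_eq_mul (⊥ : Subgroup (FreeGroup (Fin N))) x
          have hl1 : (l : FreeGroup (Fin N)) = 1 := Subgroup.mem_bot.1 l.2
          rw [Set.mem_ofPred_eq, hl, hl1, mul_one]
          exact hx
      rw [h1, Set.ncard_singleton, reducedRank_bot]
      rw [card_generators_bot] at h
      have h' : (∑ a, ((edgeCosets ⊥ T a).ncard : ℝ)) + 1 = (vertexCosets ⊥ T).ncard := by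
        exact_mod_cast h
      rw [← h']
      simp
  · have hne := nontrivial_limitSet hL
    have hinf : T.Infinite := (infinite_conv hne).mono hsub
    have h0 : {z : FreeGroup (Fin N) ⧸ L | ∃ q : Quotient (subtreeSetoid N),
        z.out • T = q.out.1} = ∅ := by
      refine Set.eq_empty_of_forall_notMem ?_
      rintro z ⟨q, hq⟩
      have := q.out.2.1
      rw [← hq] at this
      exact hinf (Set.finite_smul_set.1 this)
    rw [h0, Set.ncard_empty, Nat.cast_zero, add_zero]
    exact (reducedRank_eq hL hinv hconv ((conv_nonempty.2 hne).mono hsub) hc).symm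

variable {rep : DoubleCoset.Quotient (H : Set (FreeGroup (Fin N))) K → FreeGroup (Fin N)}

theorem out_smul_sigmaEquivProd_fst (hrep : ∀ d, DoubleCoset.mk H K (rep d) = d)
    (d : DoubleCoset.Quotient (H : Set (FreeGroup (Fin N))) K)
    (z : FreeGroup (Fin N) ⧸ (H ⊓ conjSubgroup (rep d) K)) :
    (sigmaEquivProd hrep ⟨d, z⟩).1.out • limitSet H = z.out • limitSet H := by
  rw [sigmaEquivProd_apply, out_smul_limitSet]

theorem out_smul_sigmaEquivProd_snd (hrep : ∀ d, DoubleCoset.mk H K (rep d) = d)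
    (d : DoubleCoset.Quotient (H : Set (FreeGroup (Fin N))) K)
    (z : FreeGroup (Fin N) ⧸ (H ⊓ conjSubgroup (rep d) K)) :
    (sigmaEquivProd hrep ⟨d, z⟩).2.out • limitSet K = z.out • rep d • limitSet K := by
  rw [sigmaEquivProd_apply, out_smul_limitSet, mul_smul]

theorem conv_inter_conv_sigmaEquivProd (hrep : ∀ d, DoubleCoset.mk H K (rep d) = d)
    (d : DoubleCoset.Quotient (H : Set (FreeGroup (Fin N))) K)
    (z : FreeGroup (Fin N) ⧸ (H ⊓ conjSubgroup (rep d) K)) :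
    conv ((sigmaEquivProd hrep ⟨d, z⟩).1.out • limitSet H) ∩
      conv ((sigmaEquivProd hrep ⟨d, z⟩).2.out • limitSet K) =
      z.out • coreInter H K (rep d) := by
  rw [out_smul_sigmaEquivProd_fst, out_smul_sigmaEquivProd_snd, conv_smul z.out (limitSet H),
    conv_smul z.out, ← Set.smul_set_inter, coreInter]

theorem inter_sigmaEquivProd (hH : H ≠ ⊥) (hK : K ≠ ⊥) (hHc : IsCocompact H (conv (limitSet H)))
    (hKc : IsCocompact K (conv (limitSet K))) (hrep : ∀ d, DoubleCoset.mk H K (rep d) = d)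
    (d : DoubleCoset.Quotient (H : Set (FreeGroup (Fin N))) K)
    (z : FreeGroup (Fin N) ⧸ (H ⊓ conjSubgroup (rep d) K)) :
    (sigmaEquivProd hrep ⟨d, z⟩).1.out • limitSet H ∩
      (sigmaEquivProd hrep ⟨d, z⟩).2.out • limitSet K =
      z.out • limitSet (H ⊓ conjSubgroup (rep d) K) := by
  rw [out_smul_sigmaEquivProd_fst, out_smul_sigmaEquivProd_snd, ← Set.smul_set_inter,
    limitSet_inf_conj hH hK hHc hKc]

theorem interCurrent_counting (hH : H ≠ ⊥) (hK : K ≠ ⊥)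
    (hHc : IsCocompact H (conv (limitSet H))) (hKc : IsCocompact K (conv (limitSet K))) :
    interCurrent (counting H) (counting K) =
      sumDirac fun p : (FreeGroup (Fin N) ⧸ H) × (FreeGroup (Fin N) ⧸ K) =>
        p.1.out • limitSet H ∩ p.2.out • limitSet K := by
  rw [counting_eq_sumDirac hH hHc, counting_eq_sumDirac hK hKc]
  exact interCurrent_sumDirac (limitPoint hH) (limitPoint hK)

theorem finite_mem_conv_inter (hHc : IsCocompact H (conv (limitSet H)))
    (hKc : IsCocompact K (conv (limitSet K))) (v : FreeGroup (Fin N)) :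
    {p : (FreeGroup (Fin N) ⧸ H) × (FreeGroup (Fin N) ⧸ K) |
      v ∈ conv (p.1.out • limitSet H) ∩ conv (p.2.out • limitSet K)}.Finite :=
  (finite_mem_conv_out_smul hHc v).prod (finite_mem_conv_out_smul hKc v)

theorem isSubsetCurrent_interCurrent_counting (hH : H ≠ ⊥) (hK : K ≠ ⊥)
    (hHc : IsCocompact H (conv (limitSet H))) (hKc : IsCocompact K (conv (limitSet K))) :
    IsSubsetCurrent (interCurrent (counting H) (counting K)) := by
  rw [interCurrent_counting hH hK hHc hKc]
  refine isSubsetCurrent_sumDirac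
    (fun g => ⟨(MulAction.toPerm g).prodCongr (MulAction.toPerm g), fun p => ?_⟩) fun v =>
      (finite_mem_conv_inter hHc hKc v).subset fun p hp =>
        ⟨conv_mono Set.inter_subset_left hp, conv_mono Set.inter_subset_right hp⟩
  rw [Set.smul_set_inter, smul_out_smul_limitSet, smul_out_smul_limitSet]
  rfl

theorem interCurrent_counting_eq_sum (hH : H ≠ ⊥) (hK : K ≠ ⊥)
    (hHc : IsCocompact H (conv (limitSet H))) (hKc : IsCocompact K (conv (limitSet K)))
    (hrep : ∀ d, DoubleCoset.mk H K (rep d) = d) :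
    interCurrent (counting H) (counting K) =
      Measure.sum fun d => counting (H ⊓ conjSubgroup (rep d) K) := by
  have hcount : ∀ d, counting (H ⊓ conjSubgroup (rep d) K) = sumDirac
      fun z : FreeGroup (Fin N) ⧸ (H ⊓ conjSubgroup (rep d) K) =>
        z.out • limitSet (H ⊓ conjSubgroup (rep d) K) := by
    intro d
    have hc := isCocompact_conv_limitSet_inf hHc hKc (rep d)
    generalize H ⊓ conjSubgroup (rep d) K = L at *
    by_cases hL : L = ⊥
    · subst hL
      have h0 : diracAt (∅ : Set (Boundary N)) = 0 :=
        dif_neg fun h => Set.not_nontrivial_empty h.2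
      simp only [counting_bot, limitSet_bot, Set.smul_set_empty, sumDirac, h0, Measure.sum_zero]
    · exact counting_eq_sumDirac hL hc
  rw [interCurrent_counting hH hK hHc hKc]
  ext U hU
  simp only [hcount, sumDirac, Measure.sum_apply _ hU]
  rw [← (sigmaEquivProd hrep).tsum_eq, ENNReal.tsum_sigma']
  simp only [inter_sigmaEquivProd hH hK hHc hKc hrep]

/-- Over one double coset, the translates of the hull of `Λ(L)` through `1` are counted by the
`L`-orbits of its vertices, and similarly for edges. -/
theorem hasSum_rankFunctional (hH : H ≠ ⊥) (hK : K ≠ ⊥)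
    (hHc : IsCocompact H (conv (limitSet H))) (hKc : IsCocompact K (conv (limitSet K)))
    (hrep : ∀ d, DoubleCoset.mk H K (rep d) = d) :
    HasSum (fun d => (reducedRank (H ⊓ conjSubgroup (rep d) K) : ℝ))
      (rankFunctional (interCurrent (counting H) (counting K))) := by
  have hclosed : ∀ p : (FreeGroup (Fin N) ⧸ H) × (FreeGroup (Fin N) ⧸ K),
      IsClosed (p.1.out • limitSet H ∩ p.2.out • limitSet K) := fun p =>
    (isClosed_smul_limitSet H _).inter (isClosed_smul_limitSet K _)
  have hfin : {p : (FreeGroup (Fin N) ⧸ H) × (FreeGroup (Fin N) ⧸ K) |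
      1 ∈ conv (p.1.out • limitSet H ∩ p.2.out • limitSet K)}.Finite :=
    (finite_mem_conv_inter hHc hKc 1).subset fun p hp =>
        ⟨conv_mono Set.inter_subset_left hp, conv_mono Set.inter_subset_right hp⟩
  rw [interCurrent_counting hH hK hHc hKc, rankFunctional, edgeFunctional,
    vertexFunctional_sumDirac hclosed]
  simp only [real_edgeSCyl_sumDirac hclosed]
  have hV := hasSum_ncard_fiber (sigmaEquivProd hrep) hfin
  have hE := hasSum_sum fun a (_ : a ∈ Finset.univ) => hasSum_ncard_fiber (sigmaEquivProd hrep)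
    (hfin.subset (fun p hp => hp.1 : {p : (FreeGroup (Fin N) ⧸ H) × (FreeGroup (Fin N) ⧸ K) |
      1 ∈ conv (p.1.out • limitSet H ∩ p.2.out • limitSet K) ∧
      FreeGroup.of a ∈ conv (p.1.out • limitSet H ∩ p.2.out • limitSet K)} ⊆ _))
  convert! hE.sub hV using 1
  funext d
  rw [← reducedRank_eq_conv (isCocompact_conv_limitSet_inf hHc hKc (rep d))]
  congr 1
  · refine Finset.sum_congr rfl fun a _ => ?_
    rw [← setOf_one_mem_smul_and]
    congr 2
    ext z
    simp only [Set.mem_ofPred_eq, inter_sigmaEquivProd hH hK hHc hKc hrep, conv_smul]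
  · rw [← setOf_one_mem_smul]
    congr 2
    ext z
    simp only [Set.mem_ofPred_eq, inter_sigmaEquivProd hH hK hHc hKc hrep, conv_smul]

/-- A product of two counts is a count of pairs, and both hulls contain `1` exactly when their
intersection does. So the orbit count now concerns `coreInter` instead of the hull of the limit set
of the intersection. -/
theorem hasSum_intersectionFunctional (hH : H ≠ ⊥) (hK : K ≠ ⊥)
    (hHc : IsCocompact H (conv (limitSet H))) (hKc : IsCocompact K (conv (limitSet K)))
    (hrep : ∀ d, DoubleCoset.mk H K (rep d) = d) :
    HasSum (fun d => (reducedRank (H ⊓ conjSubgroup (rep d) K) : ℝ))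
      (intersectionFunctional (counting H) (counting K)) := by
  let D : (FreeGroup (Fin N) ⧸ H) × (FreeGroup (Fin N) ⧸ K) → Set (FreeGroup (Fin N)) := fun p =>
    conv (p.1.out • limitSet H) ∩ conv (p.2.out • limitSet K)
  have hD : ∀ d z, D (sigmaEquivProd hrep ⟨d, z⟩) = z.out • coreInter H K (rep d) :=
    conv_inter_conv_sigmaEquivProd hrep
  have hfin : {p | 1 ∈ D p}.Finite := finite_mem_conv_inter hHc hKc 1
  have hvertex : vertexFunctional (counting H) * vertexFunctional (counting K) =
      ({p | 1 ∈ D p}.ncard : ℝ) := by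
    rw [counting_eq_sumDirac hH hHc, counting_eq_sumDirac hK hKc,
      vertexFunctional_sumDirac fun q => isClosed_smul_limitSet H _,
      vertexFunctional_sumDirac fun q => isClosed_smul_limitSet K _, ← Nat.cast_mul,
      ← Set.ncard_prod]
    rfl
  have hedge : ∀ a, (counting H).real (edgeSCyl a) * (counting K).real (edgeSCyl a) =
      ({p | 1 ∈ D p ∧ FreeGroup.of a ∈ D p}.ncard : ℝ) := by
    intro a
    rw [counting_eq_sumDirac hH hHc, counting_eq_sumDirac hK hKc,
      real_edgeSCyl_sumDirac fun q => isClosed_smul_limitSet H _,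
      real_edgeSCyl_sumDirac fun q => isClosed_smul_limitSet K _, ← Nat.cast_mul,
      ← Set.ncard_prod]
    congr 2
    ext p
    exact and_and_and_comm
  have hcontr : contractibleFunctional (counting H) (counting K) =
      ({p | ∃ q : Quotient (subtreeSetoid N), D p = q.out.1}.ncard : ℝ) := by
    rw [counting_eq_sumDirac hH hHc, counting_eq_sumDirac hK hKc]
    exact contractibleFunctional_sumDirac (limitPoint hH) (limitPoint hK)
  rw [intersectionFunctional, hvertex, hcontr]
  simp only [hedge]
  have hV := hasSum_ncard_fiber (sigmaEquivProd hrep) hfin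
  have hE := hasSum_sum fun a (_ : a ∈ Finset.univ) => hasSum_ncard_fiber (sigmaEquivProd hrep)
    (hfin.subset (fun p hp => hp.1 : {p | 1 ∈ D p ∧ FreeGroup.of a ∈ D p} ⊆ _))
  -- The chosen subtrees contain `1`, so these pairs are among the finitely many whose hulls both
  -- pass through `1`.
  have hC := hasSum_ncard_fiber (sigmaEquivProd hrep) (hfin.subset (by
    rintro p ⟨q, hq⟩
    rw [Set.mem_ofPred_eq, hq]
    exact q.out.2.2.1 : {p | ∃ q : Quotient (subtreeSetoid N), D p = q.out.1} ⊆ _))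
  convert! (hE.sub hV).add hC using 1
  funext d
  rw [← reducedRank_eq_coreInter hHc hKc (rep d)]
  congr 1
  · congr 1
    · refine Finset.sum_congr rfl fun a _ => ?_
      rw [← setOf_one_mem_smul_and]
      simp only [Set.mem_ofPred_eq, hD]
    · rw [← setOf_one_mem_smul]
      simp only [Set.mem_ofPred_eq, hD]
  · simp only [Set.mem_ofPred_eq, hD]

end Main

end SubsetCurrent

end

theorem theorem4p1 (N : ℕ) (hN : 2 ≤ N) (H K : Subgroup (FreeGroup (Fin N)))
    (hH : H.FG) (hK : K.FG) (hH1 : H ≠ ⊥) (hK1 : K ≠ ⊥)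
    (rep : DoubleCoset.Quotient (H : Set (FreeGroup (Fin N))) K → FreeGroup (Fin N))
    (hrep : ∀ q, DoubleCoset.mk H K (rep q) = q) :
    SubsetCurrent.IsSubsetCurrent (SubsetCurrent.counting H) ∧
    SubsetCurrent.IsSubsetCurrent (SubsetCurrent.counting K) ∧
    SubsetCurrent.IsSubsetCurrent
      (SubsetCurrent.interCurrent (SubsetCurrent.counting H) (SubsetCurrent.counting K)) ∧
    SubsetCurrent.interCurrent (SubsetCurrent.counting H) (SubsetCurrent.counting K) =
      MeasureTheory.Measure.sum (fun q =>
        SubsetCurrent.counting (H ⊓ SubsetCurrent.conjSubgroup (rep q) K)) ∧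
    SubsetCurrent.rankFunctional
        (SubsetCurrent.interCurrent (SubsetCurrent.counting H) (SubsetCurrent.counting K)) =
      SubsetCurrent.intersectionFunctional (SubsetCurrent.counting H)
        (SubsetCurrent.counting K) ∧
    HasSum (fun q =>
        (SubsetCurrent.reducedRank (H ⊓ SubsetCurrent.conjSubgroup (rep q) K) : ℝ))
      (SubsetCurrent.intersectionFunctional (SubsetCurrent.counting H)
        (SubsetCurrent.counting K)) := by
  have hHc := SubsetCurrent.isCocompact_conv_limitSet hH
  have hKc := SubsetCurrent.isCocompact_conv_limitSet hK
  have h1 := SubsetCurrent.hasSum_rankFunctional hH1 hK1 hHc hKc hrep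
  have h2 := SubsetCurrent.hasSum_intersectionFunctional hH1 hK1 hHc hKc hrep
  exact ⟨SubsetCurrent.isSubsetCurrent_counting hH1 hHc,
    SubsetCurrent.isSubsetCurrent_counting hK1 hKc,
    SubsetCurrent.isSubsetCurrent_interCurrent_counting hH1 hK1 hHc hKc,
    SubsetCurrent.interCurrent_counting_eq_sum hH1 hK1 hHc hKc hrep, h1.unique h2, h2⟩
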